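/- Let $k$ be a field of characteristic $0$ and $n\in\mathbb Z$. A (finite type) formal moduli problem $X=B\mathfrak g$ over $k$ is given by a finite-dimensional $L_\infty$ algebra $\mathfrak g=\mathbb T_o[-1]X$; equivalently, by the cohomological vector field $Q_{\mathfrak g}\in\Gamma(X,\mathbb T_X[1])$ on the graded vector space $\mathfrak g[1]$, of degree $1$, vanishing at $0$, with $[Q_{\mathfrak g},Q_{\mathfrak g}]=0$. Strict maps of formal moduli problems are degree $0$ linear maps commuting with all brackets. A (strict, constant coefficient) $n$-shifted symplectic structure on $X$ is a graded symmetric isomorphism $\omega:\mathfrak g\to\mathfrak g^*[n-2]$ with $\mathcal L_{Q_{\mathfrak g}}\omega=0$; then $Q_{\mathfrak g}$ is the Hamiltonian vector field of a unique function $S\in\mathcal O(X)=\widehat{\mathrm{Sym}}(\mathfrak g^*[-1])$ of degree $n+1$ without constant term. A map of $n$-shifted symplectic formal moduli problems is a strict map that pulls back one symplectic form to the other. A regular embedded Lagrangian $f:L\to X$, $L=B\mathfrak l$, is a strict map whose underlying linear map $\mathfrak l\to\mathfrak g$ is injective with image a Lagrangian subspace, i.e. equal to its own $\omega$-orthogonal.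 An $(n-1)$-shifted homotopy Poisson structure on $L$ is an element $\bar\Pi\in\prod_{j\ge2}\Gamma(L,\mathrm{Sym}^j(\mathbb T_L[-n]))$ of degree $n+1$ with $[Q_{\mathfrak l}+\bar\Pi,Q_{\mathfrak l}+\bar\Pi]=0$ for the Schouten bracket, i.e. the Poisson bracket of $\mathcal O(T^*[n]L)\cong\Gamma(L,\widehat{\mathrm{Sym}}(\mathbb T_L[-n]))$. The twisted cotangent bundle $T^*_{\bar\Pi}[n]L$ is the graded vector space $\mathfrak l\oplus\mathfrak l^*[n-2]$ with its canonical symplectic pairing and the cohomological vector field $Q_{T^*[n]L}+Q_{\bar\Pi}$, where $Q_{\bar\Pi}$ is the Hamiltonian vector field of $\bar\Pi$ and $Q_{T^*[n]L}$ that of $Q_{\mathfrak l}$, viewed as a function on $T^*[n]L$ linear along the fibres. The zero section $\sigma_0:L\to T^*_{\bar\Pi}[n]L$ is the inclusion of the first summand. Proposition. Let $(X,\omega)$ be an $n$-shifted symplectic formal moduli problem and $f:L\to X$ a regular embedded Lagrangian. Then the image of $\mathfrak l$ in $\mathfrak g$ has a graded complement $\mathfrak l_-$ with $\omega|_{\mathfrak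 l_-}=0$. For every such $\mathfrak l_-$, let $\mathfrak g\cong\mathfrak l\oplus\mathfrak l^*[n-2]$ be the isomorphism of graded vector spaces given by $f$ and $\omega:\mathfrak l_-\cong\mathfrak l^*[n-2]$, and let $\bar\Pi=\{S_j\}_{j\ge2}$ be formed by the components $S_j\in\Gamma(L,\mathrm{Sym}^j(\mathbb T_L[-n]))$, $j\geq 2$, of $S$. Then $\bar\Pi$ is an $(n-1)$-shifted homotopy Poisson structure on $L$, $T^*_{\bar\Pi}[n]L$ is an $n$-shifted symplectic formal moduli problem, $\sigma_0$ is a map of formal moduli problems, and there exists a map $\tilde f:T^*_{\bar\Pi}[n]L\to X$ of $n$-shifted symplectic formal moduli problems such that $\tilde f\circ\sigma_0=f$. -/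

import Mathlib

/-!
Conventions.  A (finite type, pointed) formal moduli problem `X = B𝔤` over a field `k` is modelled by
its `L_∞` algebra `𝔤 = 𝕋_o[-1] X`.  We work on the tangent complex `V = 𝕋_o X = 𝔤[1]`, a finite
dimensional `ℤ`-graded vector space with graded pieces `𝒱 i`.  The brackets
`l_r : 𝔤^{⊗ r} → 𝔤[2 - r]` become graded symmetric maps `Q_r : V^{⊗ r} → V` of degree one, which are
the Taylor coefficients at the origin of the cohomological vector field
`Q ∈ Γ(X, 𝕋_X[1]) = ∏_r Hom(Sym^r V, V)[1]`.  Likewise `𝒪(X) = ∏_r Hom(Sym^r V, k)`.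
-/

noncomputable section

namespace ShiftedPoisson

variable {k : Type*} [Field k]
variable {V : Type*} [AddCommGroup V] [Module k V]
variable {W : Type*} [AddCommGroup W] [Module k W]

/-! ### Formal functions and vector fields -/

/-- A formal power series map `V → W`, given by its Taylor coefficients, one multilinear map
`V^r → W` for every `r` (the power series is `v ↦ ∑ᵣ F_r(v, …, v) / r!`). -/
abbrev FormalMap (k V W : Type*) [Field k] [AddCommGroup V] [Module k V]
    [AddCommGroup W] [Module k W] : Type _ :=
  ∀ r : ℕ, MultilinearMap k (fun _ : Fin r => V) W

/-- The ground field in degree zero. -/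
def scalarGrading (k : Type*) [Field k] : ℤ → Submodule k k :=
  fun i => if i = 0 then ⊤ else ⊥

/-- `F` is homogeneous of cohomological degree `d` and its Taylor coefficients are graded
symmetric: exchanging two neighbouring homogeneous arguments `v_i`, `v_{i+1}` costs the Koszul sign
`(-1)^{|v_i| |v_{i+1}|}`. -/
structure IsGradedFormalMap (𝒱 : ℤ → Submodule k V) (𝒲 : ℤ → Submodule k W) (d : ℤ)
    (F : FormalMap k V W) : Prop where
  degree : ∀ (r : ℕ) (a : Fin r → ℤ) (v : Fin r → V), (∀ i, v i ∈ 𝒱 (a i)) →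
    F r v ∈ 𝒲 (∑ i, a i + d)
  symm : ∀ (r : ℕ) (a : Fin r → ℤ) (v : Fin r → V), (∀ i, v i ∈ 𝒱 (a i)) →
    ∀ i j : Fin r, (i : ℕ) + 1 = j →
      F r (v ∘ Equiv.swap i j) = (a i * a j).negOnePow • F r v

/-- The Koszul sign of the unshuffle that moves the arguments with index in `A`, in their order, in
front of the remaining ones, in their order; `a i` is the degree of the `i`-th argument. -/
def koszulSign {r : ℕ} (a : Fin r → ℤ) (A : Finset (Fin r)) : ℤˣ :=
  ∏ i ∈ A, ∏ j ∈ Aᶜ with j < i, (a i * a j).negOnePow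

/-- The derivative of `F` along the vector field `X` (the Taylor coefficients of
`v ↦ (dF)_v (X(v))`), evaluated on homogeneous arguments `v` of degrees `a`:
`∑_A ± F(X(v_A), v_{Aᶜ})`, the sum running over all unshuffles. -/
def derivAlong (F : FormalMap k V W) (X : FormalMap k V V) {r : ℕ} (a : Fin r → ℤ)
    (v : Fin r → V) : W :=
  ∑ A : Finset (Fin r), koszulSign a A •
    F (Aᶜ.card + 1)
      (Fin.cons (X A.card (v ∘ A.orderEmbOfFin rfl)) (v ∘ Aᶜ.orderEmbOfFin rfl))

/-- The graded vector space `V = 𝔤[1]` with the formal vector field `Q` is a formal moduli problem,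
that is, `Q` is an `L_∞` structure on `𝔤`: it has degree one, vanishes at the origin, and
`½ [Q, Q] = Q ∘ Q = 0`. -/
structure IsFormalModuliProblem (𝒱 : ℤ → Submodule k V) (Q : FormalMap k V V) : Prop where
  grading : DirectSum.IsInternal 𝒱
  graded : IsGradedFormalMap 𝒱 𝒱 1 Q
  pointed : Q 0 = 0
  square_zero : ∀ (r : ℕ) (a : Fin r → ℤ) (v : Fin r → V), (∀ i, v i ∈ 𝒱 (a i)) →
    derivAlong Q Q a v = 0

/-- A strict map of formal moduli problems: a degree zero linear map of the tangent complexes that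
intertwines all brackets. -/
structure IsStrictMap (𝒱 : ℤ → Submodule k V) (Q : FormalMap k V V)
    (𝒲 : ℤ → Submodule k W) (R : FormalMap k W W) (f : V →ₗ[k] W) : Prop where
  degree : ∀ (i : ℤ), ∀ v ∈ 𝒱 i, f v ∈ 𝒲 i
  comm : ∀ (r : ℕ) (v : Fin r → V), f (Q r v) = R r (fun i => f (v i))

/-! ### Shifted symplectic structures and Hamiltonian vector fields -/

/-- A strict, constant coefficient `n`-shifted symplectic structure `ω ∈ Γ(X, ∧² 𝕃_X[n])`: a graded
antisymmetric nondegenerate pairing of degree `n` on `V = 𝔤[1]` (equivalently, a graded symmetric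
isomorphism `𝔤 → 𝔤^*[n - 2]`) with `𝓛_Q ω = 0`.  In the last field `v` are the arguments of the
Taylor coefficients of `𝓛_Q ω`, and `x`, `y` are the tangent vectors on which it is evaluated. -/
structure IsShiftedSymplectic (n : ℤ) (𝒱 : ℤ → Submodule k V) (Q : FormalMap k V V)
    (ω : LinearMap.BilinForm k V) : Prop where
  degree : ∀ (i j : ℤ), ∀ x ∈ 𝒱 i, ∀ y ∈ 𝒱 j, i + j ≠ -n → ω x y = 0
  antisymm : ∀ (i j : ℤ), ∀ x ∈ 𝒱 i, ∀ y ∈ 𝒱 j, ω x y = -((i * j).negOnePow • ω y x)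
  nondegenerate : ω.Nondegenerate
  lie_derivative : ∀ (r : ℕ) (a : Fin r → ℤ) (v : Fin r → V), (∀ l, v l ∈ 𝒱 (a l)) →
    ∀ (i j : ℤ), ∀ x ∈ 𝒱 i, ∀ y ∈ 𝒱 j,
      ω (Q (r + 1) (Fin.snoc v x)) y
        + (i * (∑ l, a l + 1)).negOnePow • ω x (Q (r + 1) (Fin.snoc v y)) = 0

/-- The Hamiltonian vector field `X_F = Π_ω (dF)`, determined by
`ω(X_F(v₁, …, v_r), w) = F(v₁, …, v_r, w)`. -/
def hamiltonianVF [FiniteDimensional k V] (ω : LinearMap.BilinForm k V) (hω : ω.Nondegenerate)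
    (F : FormalMap k V k) : FormalMap k V V :=
  fun r => (ω.toDual hω).symm.toLinearMap.compMultilinearMap (F (r + 1)).curryRight

/-- The action functional `S ∈ 𝒪(X)[n + 1]`, the Hamiltonian function without constant term of the
symplectic vector field `Q`: `S(v₁, …, v_r, w) = ω(Q(v₁, …, v_r), w)`. -/
def actionFunctional (ω : LinearMap.BilinForm k V) (Q : FormalMap k V V) : FormalMap k V k
  | 0 => 0
  | r + 1 => MultilinearMap.uncurryRight (ω.compMultilinearMap (Q r))

/-- The Poisson bracket `{F, G} = X_F(G)` on homogeneous arguments `v` of degrees `a`. -/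
def poissonBracket [FiniteDimensional k V] (ω : LinearMap.BilinForm k V) (hω : ω.Nondegenerate)
    (F G : FormalMap k V k) {r : ℕ} (a : Fin r → ℤ) (v : Fin r → V) : k :=
  derivAlong G (hamiltonianVF ω hω F) a v

/-! ### The shifted cotangent bundle and polyvector fields -/

section Cotangent

variable (n : ℤ) (𝒱 : ℤ → Submodule k V)

/-- The grading of `𝕋_o(T^*[n]L) = V ⊕ V^*[n]`: a functional on `V` lies in degree `i` if it is
supported on the piece of degree `-n - i`. -/
def cotangentGrading (i : ℤ) : Submodule k (V × Module.Dual k V) :=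
  (𝒱 i).prod (⨅ j : {j : ℤ // j ≠ -n - i}, (𝒱 j.1).dualAnnihilator)

variable [DirectSum.Decomposition 𝒱]

/-- The operator `v ↦ (-1)^{m |v|} v`. -/
def signTwist (m : ℤ) : V →ₗ[k] V :=
  DirectSum.toModule k ℤ V (fun i => (m * i).negOnePow • (𝒱 i).subtype) ∘ₗ
    (DirectSum.decomposeLinearEquiv 𝒱).toLinearMap

/-- The projection onto the part of parity `e`. -/
def parityProj (e : Fin 2) : V →ₗ[k] V :=
  DirectSum.toModule k ℤ V (fun i => if i % 2 = ((e : ℕ) : ℤ) then (𝒱 i).subtype else 0) ∘ₗ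
    (DirectSum.decomposeLinearEquiv 𝒱).toLinearMap

/-- The canonical `n`-shifted symplectic pairing on `V ⊕ V^*[n]`: it is graded antisymmetric and
`ω((a, 0), (0, η)) = η(a)`. -/
def cotangentForm : LinearMap.BilinForm k (V × Module.Dual k V) :=
  LinearMap.mk₂ k (fun x y => y.2 x.1 - x.2 (signTwist 𝒱 (n + 1) y.1))
    (by intros; simp; ring) (by intros; simp; ring) (by intros; simp; ring) (by intros; simp; ring)

theorem signTwist_of_mem (m : ℤ) {i : ℤ} {v : V} (hv : v ∈ 𝒱 i) :
    signTwist 𝒱 m v = (m * i).negOnePow • v := by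
  simp only [signTwist, LinearMap.comp_apply, LinearEquiv.coe_coe,
    DirectSum.decomposeLinearEquiv_apply, DirectSum.decompose_of_mem 𝒱 hv]
  rw [← DirectSum.lof_eq_of k, DirectSum.toModule_lof]
  rfl

theorem signTwist_signTwist (m : ℤ) (v : V) : signTwist 𝒱 m (signTwist 𝒱 m v) = v := by
  induction v using DirectSum.Decomposition.inductionOn 𝒱 with
  | zero => simp
  | @homogeneous i v =>
    rw [signTwist_of_mem 𝒱 m v.2, signTwist_of_mem 𝒱 m ((𝒱 i).smul_of_tower_mem _ v.2), smul_smul]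
    simp
  | add v w hv hw => rw [map_add, map_add, hv, hw]

theorem cotangentForm_nondegenerate : (cotangentForm n 𝒱).Nondegenerate := by
  constructor
  · rintro ⟨a, ξ⟩ h
    have ha : a = 0 := by
      refine (Module.forall_dual_apply_eq_zero_iff k a).1 fun η => ?_
      simpa [cotangentForm] using h (0, η)
    have hξ : ξ = 0 := by
      ext b
      simpa [cotangentForm, signTwist_signTwist] using h (signTwist 𝒱 (n + 1) b, 0)
    rw [ha, hξ, Prod.mk_zero_zero]
  · rintro ⟨b, η⟩ h
    have hb : signTwist 𝒱 (n + 1) b = 0 := by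
      refine (Module.forall_dual_apply_eq_zero_iff k _).1 fun ξ => ?_
      simpa [cotangentForm] using h (0, ξ)
    have hη : η = 0 := by
      ext a
      simpa [cotangentForm] using h (a, 0)
    rw [← signTwist_signTwist 𝒱 (n + 1) b, hb, map_zero, hη, Prod.mk_zero_zero]

/-- A vector field `Q ∈ Γ(L, 𝕋_L[1])`, seen as a function of degree `n + 1` on `T^*[n]L` that is
linear along the fibres: `(a₁, …, a_r, ξ) ↦ ξ(Q(a₁, …, a_r))`, extended by graded symmetry.  In the
sum, `i` is the position of the covector `ξ` and `e` lists the parities of the other arguments; `ξ`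
is moved to the end past the arguments to the right of it, where only the part of `ξ` of degree
`-n - |Q(a₁, …, a_r)| = -n - 1 - ∑ |a_j|` contributes. -/
def linearHamiltonian (Q : FormalMap k V V) : FormalMap k (V × Module.Dual k V) k
  | 0 => 0
  | r + 1 => ∑ i : Fin (r + 1), ∑ e : Fin r → Fin 2,
      ((n + 1 + ∑ j, ((e j : ℕ) : ℤ)) *
          ∑ j with i ≤ Fin.castSucc j, ((e j : ℕ) : ℤ)).negOnePow •
        LinearMap.uncurryMid (M := fun _ => V × Module.Dual k V) i
          { toFun := fun x => x.2.compMultilinearMap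
              ((Q r).compLinearMap fun j => parityProj 𝒱 (e j) ∘ₗ LinearMap.fst k V _)
            map_add' := fun _ _ => rfl
            map_smul' := fun _ _ => rfl }

/-- The part of weight `j` of a function on `T^*[n]L`, that is, its component in
`Γ(L, Sym^j(𝕋_L[-n]))` under `𝒪(T^*[n]L) ≅ ∏_j Γ(L, Sym^j(𝕋_L[-n]))`. -/
def weightPart (j : ℕ) (F : FormalMap k (V × Module.Dual k V) k) :
    FormalMap k (V × Module.Dual k V) k :=
  fun r => ∑ B ∈ (Finset.univ : Finset (Fin r)).powersetCard j,
    (F r).compLinearMap fun i =>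
      if i ∈ B then LinearMap.inr k V (Module.Dual k V) ∘ₗ LinearMap.snd k V (Module.Dual k V)
      else LinearMap.inl k V (Module.Dual k V) ∘ₗ LinearMap.fst k V (Module.Dual k V)

/-- The sum of the components of weight at least two. -/
def weightGeTwo (F : FormalMap k (V × Module.Dual k V) k) : FormalMap k (V × Module.Dual k V) k :=
  fun r => ∑ j ∈ Finset.Icc 2 r, weightPart j F r

variable [FiniteDimensional k V]

/-- `P = {P_j}_{j ≥ 2} ∈ ∏_{j ≥ 2} Γ(L, Sym^j(𝕋_L[-n]))[n + 1]` is an `(n - 1)`-shifted homotopy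
Poisson structure on the formal moduli problem `L = (V, Q)`: `[Q + P, Q + P] = 0` for the Schouten
bracket of `(n - 1)`-shifted polyvector fields, which is the Poisson bracket of `T^*[n]L`. -/
structure IsHomotopyPoisson (Q : FormalMap k V V) (P : FormalMap k (V × Module.Dual k V) k) :
    Prop where
  graded : IsGradedFormalMap (cotangentGrading n 𝒱) (scalarGrading k) (n + 1) P
  weight_zero : weightPart 0 P = 0
  weight_one : weightPart 1 P = 0
  master : ∀ (r : ℕ) (a : Fin r → ℤ) (u : Fin r → V × Module.Dual k V),
    (∀ i, u i ∈ cotangentGrading n 𝒱 (a i)) →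
      poissonBracket (cotangentForm n 𝒱) (cotangentForm_nondegenerate n 𝒱)
        (linearHamiltonian n 𝒱 Q + P) (linearHamiltonian n 𝒱 Q + P) a u = 0

/-- The cohomological vector field of `T^*[n]L`, with `L_∞` algebra `𝔩 ⋉ 𝔩^*[n - 2]`. -/
def cotangentVF (Q : FormalMap k V V) :
    FormalMap k (V × Module.Dual k V) (V × Module.Dual k V) :=
  hamiltonianVF (cotangentForm n 𝒱) (cotangentForm_nondegenerate n 𝒱) (linearHamiltonian n 𝒱 Q)

/-- The vector field `Q_{T^*[n]L} + Q_P` of the twisted cotangent bundle `T^*_P[n]L`. -/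
def twistedCotangentVF (Q : FormalMap k V V) (P : FormalMap k (V × Module.Dual k V) k) :
    FormalMap k (V × Module.Dual k V) (V × Module.Dual k V) :=
  cotangentVF n 𝒱 Q +
    hamiltonianVF (cotangentForm n 𝒱) (cotangentForm_nondegenerate n 𝒱) P

/-- The zero section `L → T^*_P[n]L`. -/
def zeroSection (k V : Type*) [Field k] [AddCommGroup V] [Module k V] :
    V →ₗ[k] V × Module.Dual k V :=
  LinearMap.inl k V (Module.Dual k V)

end Cotangent

/-! ### Regular embedded Lagrangians and the induced Poisson structure -/

section Lagrangian

variable {T : Type*} [AddCommGroup T] [Module k T]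

/-- A strict map with underlying linear map `f : V → T` is a regular embedded Lagrangian: `f` is
injective and its image is a Lagrangian subspace, equal to its own `ω`-orthogonal. -/
structure IsRegularEmbeddedLagrangian (ω : LinearMap.BilinForm k T) (f : V →ₗ[k] T) : Prop where
  injective : Function.Injective f
  isotropic : ∀ a b : V, ω (f a) (f b) = 0
  coisotropic : ∀ x : T, (∀ a : V, ω (f a) x = 0) → x ∈ LinearMap.range f

/-- A graded isotropic complement `𝔩₋` to the image `𝔩₊` of `f`. -/
structure IsIsotropicComplement (𝒯 : ℤ → Submodule k T) [DirectSum.Decomposition 𝒯]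
    (ω : LinearMap.BilinForm k T) (f : V →ₗ[k] T) (C : Submodule k T) : Prop where
  homogeneous : DirectSum.SetLike.IsHomogeneous 𝒯 C
  isCompl : IsCompl (LinearMap.range f) C
  isotropic : ∀ x ∈ C, ∀ y ∈ C, ω x y = 0

/-- The map `𝔩₋ → 𝔩₊^*` induced by `ω`, namely `w ↦ (a ↦ ω(f a, w))`. -/
def complementToDual (ω : LinearMap.BilinForm k T) (f : V →ₗ[k] T) (C : Submodule k T) :
    C →ₗ[k] Module.Dual k V :=
  LinearMap.compl₂ (ω ∘ₗ f) C.subtype |>.flip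

theorem complementToDual_bijective [FiniteDimensional k T] {ω : LinearMap.BilinForm k T}
    (hω : ω.Nondegenerate) {f : V →ₗ[k] T} (hf : IsRegularEmbeddedLagrangian ω f)
    {C : Submodule k T} (hC : IsCompl (LinearMap.range f) C) :
    Function.Bijective (complementToDual ω f C) := by
  constructor
  · rw [injective_iff_map_eq_zero]
    intro w hw
    have h : (w : T) ∈ LinearMap.range f :=
      hf.coisotropic w fun a => LinearMap.congr_fun hw a
    exact Subtype.ext (Submodule.disjoint_def.1 hC.disjoint _ h w.2)
  · intro ξ
    obtain ⟨g, hg⟩ := f.exists_leftInverse_of_injective (LinearMap.ker_eq_bot.2 hf.injective)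
    obtain ⟨x, hx⟩ := (ω.flip.toDual hω.flip).surjective (ξ ∘ₗ g)
    have hx' : ∀ a, ω (f a) x = ξ a := fun a => by
      have h1 := LinearMap.congr_fun hx (f a)
      rw [LinearMap.BilinForm.toDual_def] at h1
      have h2 : g (f a) = a := LinearMap.congr_fun hg a
      simpa [h2] using h1
    obtain ⟨y, ⟨b, rfl⟩, w, hw, rfl⟩ := Submodule.mem_sup.1
      (hC.sup_eq_top ▸ Submodule.mem_top : x ∈ LinearMap.range f ⊔ C)
    refine ⟨⟨w, hw⟩, LinearMap.ext fun a => ?_⟩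
    have h := hx' a
    rw [map_add, hf.isotropic, zero_add] at h
    exact h

/-- The linear map `𝕋_o(T^*[n]L) = 𝔩₊[1] ⊕ (𝔩₊[1])^*[n] → 𝔩₊[1] ⊕ 𝔩₋[1] = 𝕋_o X` given by `f` and
the inverse of the isomorphism `𝔩₋ ≅ 𝔩₊^*[n - 2]`. -/
def splitting [FiniteDimensional k T] {ω : LinearMap.BilinForm k T}
    (hω : ω.Nondegenerate) {f : V →ₗ[k] T} (hf : IsRegularEmbeddedLagrangian ω f)
    {C : Submodule k T} (hC : IsCompl (LinearMap.range f) C) :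
    V × Module.Dual k V →ₗ[k] T :=
  f.coprod (C.subtype ∘ₗ
    (LinearEquiv.ofBijective (complementToDual ω f C)
      (complementToDual_bijective hω hf hC)).symm.toLinearMap)

/-- The polyvector field `{S_j}_{j ≥ 2}` on the Lagrangian: the components of weight at least two of
the action functional `S` of `X = (T, Q, ω)`, transported to `V ⊕ V^*[n]` along the splitting. -/
def inducedPoisson [FiniteDimensional k T] {ω : LinearMap.BilinForm k T} (Q : FormalMap k T T)
    (hω : ω.Nondegenerate) {f : V →ₗ[k] T} (hf : IsRegularEmbeddedLagrangian ω f)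
    {C : Submodule k T} (hC : IsCompl (LinearMap.range f) C) :
    FormalMap k (V × Module.Dual k V) k :=
  weightGeTwo fun r => (actionFunctional ω Q r).compLinearMap fun _ => splitting hω hf hC

/-- The vector field of the twisted cotangent bundle of the Lagrangian `L = (V, R)` for the induced
Poisson structure. -/
def inducedTwistedVF [FiniteDimensional k T] [FiniteDimensional k V] (n : ℤ)
    (𝒱 : ℤ → Submodule k V) [DirectSum.Decomposition 𝒱] (R : FormalMap k V V)
    {ω : LinearMap.BilinForm k T} (Q : FormalMap k T T)
    (hω : ω.Nondegenerate) {f : V →ₗ[k] T} (hf : IsRegularEmbeddedLagrangian ω f)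
    {C : Submodule k T} (hC : IsCompl (LinearMap.range f) C) :
    FormalMap k (V × Module.Dual k V) (V × Module.Dual k V) :=
  twistedCotangentVF n 𝒱 R (inducedPoisson Q hω hf hC)

end Lagrangian

end ShiftedPoisson

end

open ShiftedPoisson

/-! Everything follows from one graded linear isomorphism. For an isotropic graded complement, the
map `splitting`, written Φ : V ⊕ V^*[n] → T, carries the canonical pairing to ω
(`apply_splitting_splitting`) and identifies the gradings (`mem_cotangentGrading_iff`). Sort S ∘ Φ
by the number of covector arguments. The part of weight 0 is ω(Q(f a₁, …), f a) = ω(f R(a₁, …), f a)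
= 0, because f is strict with isotropic image. The part of weight 1 is, up to Koszul signs, ω(f
R(a₁, …), Φ(0, ξ)) = ξ(R(a₁, …)), the fibrewise linear function of R. The rest is Π̄ by definition.
This is `linearHamiltonian_add_inducedPoisson`.

Since Φ is symplectic, the Hamiltonian vector field of S ∘ Φ, which is that of the twisted cotangent
bundle, corresponds to Q (`splitting_inducedTwistedVF`). Hence the L_∞ and symplectic structures
transport along Φ, the required f̃ is Φ itself, and the equation for Π̄ is the pullback of {S, S} =
0. The latter is `derivAlong_actionFunctional`: the unshuffles in the derivative of S along Q split
according to whether the last argument w stays outside Q or enters it, and each half equals ω(Q ∘ Q,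
w), the second one by 𝓛_Q ω = 0.

An isotropic complement is obtained from any graded one by a shift along the Lagrangian that absorbs
half of the form on it (`exists_isIsotropicComplement`). -/

noncomputable section

namespace ShiftedPoisson

variable {k : Type*} [Field k]
variable {V : Type*} [AddCommGroup V] [Module k V]
variable {W : Type*} [AddCommGroup W] [Module k W]
variable {U : Type*} [AddCommGroup U] [Module k U]
variable {U' : Type*} [AddCommGroup U'] [Module k U']

/-! ### Signs -/

theorem negOnePow_congr {m n : ℤ} (h : Even (m - n)) : m.negOnePow = n.negOnePow :=
  (Int.negOnePow_eq_iff m n).2 h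

theorem neg_eq_negOnePow_smul (x : V) : -x = (1 : ℤ).negOnePow • x := by simp

theorem negOnePow_smul_smul (m n : ℤ) (x : V) :
    m.negOnePow • n.negOnePow • x = (m + n).negOnePow • x := by
  rw [smul_smul, Int.negOnePow_add]

theorem prod_negOnePow {ι : Type*} (s : Finset ι) (g : ι → ℤ) :
    ∏ i ∈ s, (g i).negOnePow = (∑ i ∈ s, g i).negOnePow := by
  classical
  induction s using Finset.induction_on with
  | empty => simp
  | insert i s hi ih => rw [Finset.prod_insert hi, Finset.sum_insert hi, ih, Int.negOnePow_add]

theorem map_units_smul (φ : V →ₗ[k] W) (ε : ℤˣ) (x : V) : φ (ε • x) = ε • φ x := by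
  rcases Int.units_eq_one_or ε with rfl | rfl <;> simp

/-! ### Graded linear maps and homogeneous elements -/

/-- A linear map of degree zero. -/
def IsDegreeZero (𝒱 : ℤ → Submodule k V) (𝒲 : ℤ → Submodule k W) (φ : V →ₗ[k] W) : Prop :=
  ∀ (i : ℤ), ∀ v ∈ 𝒱 i, φ v ∈ 𝒲 i

theorem coe_decompose_map {𝒱 : ℤ → Submodule k V} {𝒲 : ℤ → Submodule k W}
    [DirectSum.Decomposition 𝒱] [DirectSum.Decomposition 𝒲] {φ : V →ₗ[k] W}
    (hφ : IsDegreeZero 𝒱 𝒲 φ) (v : V) (i : ℤ) :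
    (DirectSum.decompose 𝒲 (φ v) i : W) = φ (DirectSum.decompose 𝒱 v i) := by
  induction v using DirectSum.Decomposition.inductionOn 𝒱 with
  | zero => simp
  | @homogeneous j v =>
    by_cases h : j = i
    · subst h
      rw [DirectSum.decompose_of_mem_same _ (hφ _ _ v.2), DirectSum.decompose_of_mem_same _ v.2]
    · rw [DirectSum.decompose_of_mem_ne _ (hφ _ _ v.2) h, DirectSum.decompose_of_mem_ne _ v.2 h,
        map_zero]
  | add v w hv hw => simp [hv, hw]

theorem mem_of_forall_decompose_eq_zero {𝒱 : ℤ → Submodule k V} [DirectSum.Decomposition 𝒱]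
    {v : V} {i : ℤ} (h : ∀ l ≠ i, (DirectSum.decompose 𝒱 v l : V) = 0) : v ∈ 𝒱 i := by
  classical
  have : v = (DirectSum.decompose 𝒱 v i : V) := by
    apply (DirectSum.decompose 𝒱).injective
    refine DFinsupp.ext fun l => Subtype.ext ?_
    by_cases hl : l = i
    · subst hl
      rw [DirectSum.decompose_of_mem_same _ (DirectSum.decompose 𝒱 v l).2]
    · rw [h l hl, DirectSum.decompose_of_mem_ne _ (DirectSum.decompose 𝒱 v i).2 (Ne.symm hl)]
  rw [this]
  exact (DirectSum.decompose 𝒱 v i).2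

theorem linearMap_ext_homogeneous {𝒱 : ℤ → Submodule k V} [DirectSum.Decomposition 𝒱]
    {φ ψ : V →ₗ[k] W} (h : ∀ (i : ℤ), ∀ v ∈ 𝒱 i, φ v = ψ v) : φ = ψ := by
  ext v
  induction v using DirectSum.Decomposition.inductionOn 𝒱 with
  | zero => simp
  | homogeneous v => exact h _ _ v.2
  | add v w hv hw => simp [hv, hw]

/-- Bases of the graded pieces collect to a homogeneous basis, which determines a multilinear map.
Koszul signs only make sense on such arguments. -/
theorem multilinearMap_ext_homogeneous {𝒱 : ℤ → Submodule k V} (h𝒱 : DirectSum.IsInternal 𝒱)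
    {r : ℕ} {F G : MultilinearMap k (fun _ : Fin r => V) W}
    (h : ∀ (a : Fin r → ℤ) (v : Fin r → V), (∀ i, v i ∈ 𝒱 (a i)) → F v = G v) : F = G := by
  classical
  let b := h𝒱.collectedBasis fun i => Module.Free.chooseBasis k (𝒱 i)
  refine Module.Basis.ext_multilinear (fun _ => b) fun v => ?_
  exact h (fun i => (v i).1) _ fun i => h𝒱.collectedBasis_mem _ _

/-- A degree zero modification of a linear map, which keeps only the matrix entries between pieces
of the same degree. -/
def degreeZeroPart (𝒱 : ℤ → Submodule k V) (𝒲 : ℤ → Submodule k W)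
    [DirectSum.Decomposition 𝒱] [DirectSum.Decomposition 𝒲] (φ : V →ₗ[k] W) : V →ₗ[k] W :=
  DirectSum.toModule k ℤ W (fun i => (𝒲 i).subtype ∘ₗ DirectSum.component k ℤ (fun i => 𝒲 i) i ∘ₗ
    (DirectSum.decomposeLinearEquiv 𝒲).toLinearMap ∘ₗ φ ∘ₗ (𝒱 i).subtype) ∘ₗ
    (DirectSum.decomposeLinearEquiv 𝒱).toLinearMap

theorem degreeZeroPart_of_mem (𝒱 : ℤ → Submodule k V) (𝒲 : ℤ → Submodule k W)
    [DirectSum.Decomposition 𝒱] [DirectSum.Decomposition 𝒲] (φ : V →ₗ[k] W) {i : ℤ} {v : V}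
    (hv : v ∈ 𝒱 i) : degreeZeroPart 𝒱 𝒲 φ v = DirectSum.decompose 𝒲 (φ v) i := by
  simp only [degreeZeroPart, LinearMap.comp_apply, LinearEquiv.coe_coe,
    DirectSum.decomposeLinearEquiv_apply, DirectSum.decompose_of_mem 𝒱 hv]
  rw [← DirectSum.lof_eq_of k, DirectSum.toModule_lof]
  rfl

theorem isDegreeZero_degreeZeroPart (𝒱 : ℤ → Submodule k V) (𝒲 : ℤ → Submodule k W)
    [DirectSum.Decomposition 𝒱] [DirectSum.Decomposition 𝒲] (φ : V →ₗ[k] W) :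
    IsDegreeZero 𝒱 𝒲 (degreeZeroPart 𝒱 𝒲 φ) := fun i v hv => by
  rw [degreeZeroPart_of_mem 𝒱 𝒲 φ hv]
  exact (DirectSum.decompose 𝒲 (φ v) i).2

/-- Any linear left inverse may be stripped of its entries of nonzero degree: as φ preserves
degrees, these do not contribute to the identity. -/
theorem exists_isDegreeZero_leftInverse {𝒱 : ℤ → Submodule k V} {𝒲 : ℤ → Submodule k W}
    [DirectSum.Decomposition 𝒱] [DirectSum.Decomposition 𝒲] {φ : V →ₗ[k] W}
    (hφ : IsDegreeZero 𝒱 𝒲 φ) (hinj : Function.Injective φ) :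
    ∃ ψ : W →ₗ[k] V, IsDegreeZero 𝒲 𝒱 ψ ∧ ∀ v, ψ (φ v) = v := by
  obtain ⟨g, hg⟩ := φ.exists_leftInverse_of_injective (LinearMap.ker_eq_bot.2 hinj)
  refine ⟨degreeZeroPart 𝒲 𝒱 g, isDegreeZero_degreeZeroPart _ _ _, fun v => ?_⟩
  have : degreeZeroPart 𝒲 𝒱 g ∘ₗ φ = LinearMap.id := by
    refine linearMap_ext_homogeneous (𝒱 := 𝒱) fun i v hv => ?_
    have h : g (φ v) = v := LinearMap.congr_fun hg v
    rw [LinearMap.comp_apply, degreeZeroPart_of_mem _ _ _ (hφ i v hv), h,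
      DirectSum.decompose_of_mem_same _ hv, LinearMap.id_apply]
  exact LinearMap.congr_fun this v

/-! ### Graded antisymmetric pairings -/

section Pairing

variable {n : ℤ} {𝒱 : ℤ → Submodule k V} [DirectSum.Decomposition 𝒱]
  {Q : FormalMap k V V} {ω : LinearMap.BilinForm k V}

/-- The form pairs degrees i and j only if i + j = -n, and then ij = -(n + j)j has the parity of (n
+ 1)j. The sign thus depends on y alone, so x need not be homogeneous; this is the sign in
`signTwist`. -/
theorem IsShiftedSymplectic.apply_eq_neg_flip (hω : IsShiftedSymplectic n 𝒱 Q ω) (x : V) {j : ℤ}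
    {y : V} (hy : y ∈ 𝒱 j) : ω x y = -(((n + 1) * j).negOnePow • ω y x) := by
  induction x using DirectSum.Decomposition.inductionOn 𝒱 with
  | zero => simp
  | @homogeneous i x =>
    by_cases h : i + j = -n
    · rw [hω.antisymm i j x x.2 y hy]
      congr 2
      apply negOnePow_congr
      obtain rfl : i = -n - j := by omega
      have := Int.even_mul_succ_self j
      obtain ⟨c, hc⟩ := this
      exact ⟨-n * j - c, by linear_combination -hc⟩
    · rw [hω.degree i j x x.2 y hy h, hω.degree j i y hy x x.2 (by omega)]
      simp
  | add v w hv hw => simp only [map_add, LinearMap.add_apply, hv, hw, smul_add, neg_add]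

theorem IsShiftedSymplectic.apply_eq_zero_comm (hω : IsShiftedSymplectic n 𝒱 Q ω) (x : V) {j : ℤ}
    {y : V} (hy : y ∈ 𝒱 j) : ω x y = 0 ↔ ω y x = 0 := by
  rw [hω.apply_eq_neg_flip x hy, neg_eq_zero, smul_eq_zero_iff_eq]

/-- A component of x in degree l ≠ i pairs to zero with degree -n - l by assumption and with all
other degrees because ω has degree n, so nondegeneracy kills it. -/
theorem IsShiftedSymplectic.mem_of_forall_apply_eq_zero (hω : IsShiftedSymplectic n 𝒱 Q ω) {x : V}
    {i : ℤ} (h : ∀ j ≠ -n - i, ∀ y ∈ 𝒱 j, ω x y = 0) : x ∈ 𝒱 i := by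
  classical
  have hcomp : ∀ (l : ℤ), ∀ y ∈ 𝒱 (-n - l), ω x y = ω (DirectSum.decompose 𝒱 x l) y := by
    intro l y hy
    clear h
    induction x using DirectSum.Decomposition.inductionOn 𝒱 with
    | zero => simp
    | @homogeneous m x =>
      by_cases hm : m = l
      · subst hm
        rw [DirectSum.decompose_of_mem_same _ x.2]
      · rw [DirectSum.decompose_of_mem_ne _ x.2 hm, map_zero,
          hω.degree m _ x x.2 y hy (by omega), LinearMap.zero_apply]
    | add v w hv hw => simp [hv, hw]
  refine mem_of_forall_decompose_eq_zero fun l hl => hω.nondegenerate.1 _ fun y => ?_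
  have : ω (DirectSum.decompose 𝒱 x l) = 0 := by
    refine linearMap_ext_homogeneous (𝒱 := 𝒱) fun j y hy => ?_
    rw [LinearMap.zero_apply]
    by_cases hj : j = -n - l
    · subst hj
      rw [← hcomp l y hy, h _ (by omega) y hy]
    · exact hω.degree l j _ (DirectSum.decompose 𝒱 x l).2 y hy (by omega)
  rw [this, LinearMap.zero_apply]

end Pairing

/-! ### Existence of an isotropic complement -/

section Complement

variable {T : Type*} [AddCommGroup T] [Module k T]
  {n : ℤ} {𝒯 : ℤ → Submodule k T} [DirectSum.Decomposition 𝒯]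
  {𝒱 : ℤ → Submodule k V} [DirectSum.Decomposition 𝒱]
  {Q : FormalMap k T T} {ω : LinearMap.BilinForm k T} {f : V →ₗ[k] T}

theorem IsShiftedSymplectic.mem_range_of_forall_apply_eq_zero (hω : IsShiftedSymplectic n 𝒯 Q ω)
    (hf : IsDegreeZero 𝒱 𝒯 f) (hL : IsRegularEmbeddedLagrangian ω f) {x : T}
    (h : ∀ a, ω x (f a) = 0) : x ∈ LinearMap.range f := by
  refine hL.coisotropic x fun a => ?_
  have : ω.flip x ∘ₗ f = 0 := by
    refine linearMap_ext_homogeneous (𝒱 := 𝒱) fun i a ha => ?_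
    exact (hω.apply_eq_zero_comm x (hf i a ha)).1 (h a)
  exact LinearMap.congr_fun this a

/-- The range of p is a graded complement, on which ω may be nonzero. The defect ω(p x, p y) is
represented by an endomorphism θ with values in the Lagrangian, so subtracting a multiple of θ keeps
a complement, and ω(θ x, θ y) = 0 leaves only terms linear in the correction. -/
theorem exists_isIsotropicComplement [CharZero k] [FiniteDimensional k T]
    (hω : IsShiftedSymplectic n 𝒯 Q ω)
    (hf : IsDegreeZero 𝒱 𝒯 f) (hL : IsRegularEmbeddedLagrangian ω f) :
    ∃ C : Submodule k T, IsIsotropicComplement 𝒯 ω f C := by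
  classical
  obtain ⟨g, hg, hgf⟩ := exists_isDegreeZero_leftInverse hf hL.injective
  -- the projection onto a graded complement, and the correction term along `f`
  let p : T →ₗ[k] T := LinearMap.id - f ∘ₗ g
  have hp : ∀ x, p x = x - f (g x) := fun x => rfl
  have hpf : ∀ a, p (f a) = 0 := fun a => by rw [hp, hgf, sub_self]
  have hpp : ∀ x, p (p x) = p x := fun x => by
    conv_lhs => rw [hp x, map_sub, hpf, sub_zero]
  have hpdeg : IsDegreeZero 𝒯 𝒯 p := fun i x hx =>
    (𝒯 i).sub_mem hx (hf i _ (hg i x hx))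
  let θ : T →ₗ[k] T := (ω.toDual hω.nondegenerate).symm.toLinearMap ∘ₗ (ω.compl₁₂ p p)
  have hθ : ∀ x y, ω (θ x) y = ω (p x) (p y) := fun x y =>
    LinearMap.BilinForm.apply_toDual_symm_apply (hB := hω.nondegenerate) _ _
  have hθp : ∀ x, θ (p x) = θ x := fun x => by
    have : ω.compl₁₂ p p (p x) = ω.compl₁₂ p p x := by
      ext y
      simp [hpp]
    simp only [θ, LinearMap.comp_apply, this]
  have hθrange : ∀ x, θ x ∈ LinearMap.range f := fun x =>
    hω.mem_range_of_forall_apply_eq_zero hf hL fun a => by rw [hθ, hpf, map_zero]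
  have hθdeg : IsDegreeZero 𝒯 𝒯 θ := fun i x hx =>
    hω.mem_of_forall_apply_eq_zero fun j hj y hy => by
      rw [hθ]
      exact hω.degree i j _ (hpdeg i x hx) _ (hpdeg j y hy) (by omega)
  have hpθ : ∀ x y, ω (p x) (θ y) = ω (p x) (p y) := by
    have : ω.compl₁₂ p θ = ω.compl₁₂ p p := by
      refine linearMap_ext_homogeneous (𝒱 := 𝒯) fun i x hx =>
        linearMap_ext_homogeneous (𝒱 := 𝒯) fun j y hy => ?_
      simp only [LinearMap.compl₁₂_apply]
      rw [hω.antisymm i j _ (hpdeg i x hx) _ (hθdeg j y hy), hθ, hpp,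
        hω.antisymm i j _ (hpdeg i x hx) _ (hpdeg j y hy)]
    intro x y
    exact LinearMap.congr_fun (LinearMap.congr_fun this x) y
  -- Both cross terms ω(θ x, p y) and ω(p x, θ y) equal ω(p x, p y), so each has to cancel one half
  -- of it.
  let ψ : T →ₗ[k] T := p - (2⁻¹ : k) • θ
  have hψ : ∀ x, ψ x = p x - (2⁻¹ : k) • θ x := fun x => rfl
  have hψdeg : IsDegreeZero 𝒯 𝒯 ψ := fun i x hx =>
    (𝒯 i).sub_mem (hpdeg i x hx) ((𝒯 i).smul_mem _ (hθdeg i x hx))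
  refine ⟨LinearMap.range ψ, ?_, ?_, ?_⟩
  · rintro i _ ⟨x, rfl⟩
    exact ⟨DirectSum.decompose 𝒯 x i, (coe_decompose_map hψdeg x i).symm⟩
  · refine ⟨Submodule.disjoint_def.2 ?_, codisjoint_iff_le_sup.2 fun x _ => ?_⟩
    -- If ψ x lies in the Lagrangian, so does p x, because θ x does. Then p x = p (p x) = 0, and θ x
    -- = θ (p x) = 0.
    · rintro _ ⟨a, ha⟩ ⟨x, rfl⟩
      obtain ⟨b, hb⟩ := hθrange x
      have hpx : p x = 0 := by
        have : p x = f (a + (2⁻¹ : k) • b) := by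
          rw [map_add, map_smul, ha, hb, hψ, sub_add_cancel]
        rw [← hpp, this, hpf]
      rw [hψ, ← hθp, hpx, map_zero, smul_zero, sub_zero]
    · refine Submodule.mem_sup.2 ⟨f (g x) + (2⁻¹ : k) • θ x, ?_, ψ x, ⟨x, rfl⟩, ?_⟩
      · exact Submodule.add_mem _ ⟨g x, rfl⟩ (Submodule.smul_mem _ _ (hθrange x))
      · rw [hψ, hp]
        abel
  · rintro _ ⟨x, rfl⟩ _ ⟨y, rfl⟩
    obtain ⟨a, ha⟩ := hθrange x
    obtain ⟨b, hb⟩ := hθrange y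
    have hθθ : ω (θ x) (θ y) = 0 := by rw [← ha, ← hb, hL.isotropic]
    simp only [hψ, map_sub, map_smul, LinearMap.sub_apply, LinearMap.smul_apply, hθθ, hθ, hpp, hpθ,
      smul_eq_mul]
    ring

end Complement

/-! ### Formal maps -/

theorem IsGradedFormalMap.compLinearMap {𝒱 : ℤ → Submodule k V} {𝒲 : ℤ → Submodule k W}
    {𝒰 : ℤ → Submodule k U} {d : ℤ} {F : FormalMap k W U} (hF : IsGradedFormalMap 𝒲 𝒰 d F)
    {φ : V →ₗ[k] W} (hφ : IsDegreeZero 𝒱 𝒲 φ) :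
    IsGradedFormalMap 𝒱 𝒰 d (fun r => (F r).compLinearMap fun _ => φ) where
  degree r a v hv := hF.degree r a (fun i => φ (v i)) fun i => hφ _ _ (hv i)
  symm r a v hv i j hij := hF.symm r a (fun i => φ (v i)) (fun i => hφ _ _ (hv i)) i j hij

/-- Naturality for φ-related vector fields. Taking ψ = φ transports Q ∘ Q, and ψ = id transports the
master equation. -/
theorem map_derivAlong {F : FormalMap k V U} {G : FormalMap k W U'} {X : FormalMap k V V}
    {Y : FormalMap k W W} (φ : V →ₗ[k] W) (ψ : U →ₗ[k] U')
    (hX : ∀ r v, φ (X r v) = Y r fun i => φ (v i)) (hF : ∀ r v, ψ (F r v) = G r fun i => φ (v i))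
    {r : ℕ} (a : Fin r → ℤ) (v : Fin r → V) :
    ψ (derivAlong F X a v) = derivAlong G Y a fun i => φ (v i) := by
  rw [derivAlong, derivAlong, map_sum]
  refine Finset.sum_congr rfl fun A _ => ?_
  rw [map_units_smul, hF]
  congr 2
  funext i
  refine Fin.cases ?_ (fun i => ?_) i
  · simp only [Fin.cons_zero]
    exact hX _ _
  · simp

/-- Moving one argument of a graded symmetric map to the last position. -/
theorem IsGradedFormalMap.apply_insertNth {𝒱 : ℤ → Submodule k V} {𝒲 : ℤ → Submodule k W}
    {d : ℤ} {F : FormalMap k V W} (hF : IsGradedFormalMap 𝒱 𝒲 d F) {r : ℕ} {a : Fin r → ℤ}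
    {v : Fin r → V} (hv : ∀ i, v i ∈ 𝒱 (a i)) {b : ℤ} {x : V} (hx : x ∈ 𝒱 b) (i : Fin (r + 1)) :
    F (r + 1) (i.insertNth (α := fun _ => V) x v) =
      (b * ∑ j with i ≤ Fin.castSucc j, a j).negOnePow • F (r + 1) (Fin.snoc v x) := by
  induction i using Fin.reverseInduction with
  | last =>
    have : (Finset.univ.filter fun j : Fin r => Fin.last r ≤ Fin.castSucc j) = ∅ := by
      ext j
      simp
    rw [this, Fin.insertNth_last']
    simp
  | cast i ih =>
    -- Insertion at i differs from insertion at i + 1 by one neighbouring transposition, which moves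
    -- x past the i-th entry of v.
    have hswap : (i.castSucc.insertNth (α := fun _ => V) x v) =
        (i.succ.insertNth (α := fun _ => V) x v) ∘ Equiv.swap i.castSucc i.succ := by
      refine Fin.insertNth_eq_iff.2 ⟨by simp, funext fun j => ?_⟩
      by_cases hj : j = i
      · subst hj
        have h : j.castSucc = j.succ.succAbove j := (Fin.succAbove_succ_self j).symm
        simp only [Fin.removeNth_apply, Function.comp_apply, Fin.succAbove_castSucc_self,
          Equiv.swap_apply_right]
        rw [h, Fin.insertNth_apply_succAbove]
      · have h : i.castSucc.succAbove j = i.succ.succAbove j := by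
          rcases lt_or_gt_of_ne hj with hlt | hgt
          · rw [Fin.succAbove_of_castSucc_lt _ _ (by simpa using hlt),
              Fin.succAbove_of_castSucc_lt _ _ (by simpa using hlt.le)]
          · rw [Fin.succAbove_of_le_castSucc _ _ (by simpa using hgt.le),
              Fin.succAbove_of_le_castSucc _ _ (by simpa [Fin.le_def] using hgt)]
        simp only [Fin.removeNth_apply, Function.comp_apply]
        rw [Equiv.swap_apply_of_ne_of_ne (Fin.succAbove_ne _ _) (h ▸ Fin.succAbove_ne _ _), h,
          Fin.insertNth_apply_succAbove]
    have hmem : ∀ l, (i.succ.insertNth (α := fun _ => V) x v) l ∈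
        𝒱 ((i.succ.insertNth (α := fun _ => ℤ) b a) l) := by
      intro l
      refine Fin.succAboveCases i.succ ?_ (fun j => ?_) l
      · simpa using hx
      · simpa using hv j
    rw [hswap, hF.symm (r + 1) _ _ hmem _ _ (by simp), ih, negOnePow_smul_smul]
    have hset : (Finset.univ.filter fun j : Fin r => i.castSucc ≤ Fin.castSucc j) =
        insert i (Finset.univ.filter fun j : Fin r => i.succ ≤ Fin.castSucc j) := by
      ext j
      simp only [Finset.mem_filter, Finset.mem_univ, true_and, Finset.mem_insert, Fin.le_def,
        Fin.ext_iff, Fin.val_castSucc, Fin.val_succ]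
      omega
    rw [hset, Finset.sum_insert (by simp [Fin.le_def])]
    have h1 : i.succ.insertNth (α := fun _ => ℤ) b a i.castSucc = a i := by
      rw [← Fin.succAbove_succ_self i, Fin.insertNth_apply_succAbove]
    rw [h1, Fin.insertNth_apply_same]
    congr 2
    ring

theorem IsGradedFormalMap.apply_cons {𝒱 : ℤ → Submodule k V} {𝒲 : ℤ → Submodule k W}
    {d : ℤ} {F : FormalMap k V W} (hF : IsGradedFormalMap 𝒱 𝒲 d F) {r : ℕ} {a : Fin r → ℤ}
    {v : Fin r → V} (hv : ∀ i, v i ∈ 𝒱 (a i)) {b : ℤ} {x : V} (hx : x ∈ 𝒱 b) :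
    F (r + 1) (Fin.cons x v) = (b * ∑ j, a j).negOnePow • F (r + 1) (Fin.snoc v x) := by
  have h := hF.apply_insertNth hv hx 0
  rw [Fin.insertNth_zero'] at h
  simpa using h

/-! ### Sums over unshuffles -/

/-- The term of `derivAlong` indexed by `A`, for any parametrizations of `A` and `Aᶜ` in
increasing order. -/
theorem derivAlong_term_eq (F : FormalMap k V W) (X : FormalMap k V V) {r : ℕ} (v : Fin r → V)
    (A : Finset (Fin r)) {p q : ℕ} (e : Fin p → Fin r) (g : Fin q → Fin r) (he : StrictMono e)
    (hg : StrictMono g) (heA : ∀ i, i ∈ A ↔ i ∈ Set.range e) (hgA : ∀ i, i ∉ A ↔ i ∈ Set.range g) :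
    F (Aᶜ.card + 1)
      (Fin.cons (X A.card (v ∘ A.orderEmbOfFin rfl)) (v ∘ Aᶜ.orderEmbOfFin rfl)) =
    F (q + 1) (Fin.cons (X p (v ∘ e)) (v ∘ g)) := by
  have hp : A.card = p := by
    have : A = Finset.univ.map ⟨e, he.injective⟩ := by
      ext i
      simp [heA]
    rw [this, Finset.card_map, Finset.card_univ, Fintype.card_fin]
  have hq : Aᶜ.card = q := by
    have : Aᶜ = Finset.univ.map ⟨g, hg.injective⟩ := by
      ext i
      simp [hgA]
    rw [this, Finset.card_map, Finset.card_univ, Fintype.card_fin]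
  subst hp hq
  rw [Finset.orderEmbOfFin_unique rfl (fun x => (heA _).2 ⟨x, rfl⟩) he,
    Finset.orderEmbOfFin_unique rfl (fun x => Finset.mem_compl.2 ((hgA _).2 ⟨x, rfl⟩)) hg]

theorem sum_finset_fin_succ {M : Type*} [AddCommMonoid M] {r : ℕ} (φ : Finset (Fin (r + 1)) → M) :
    ∑ A, φ A = ∑ A : Finset (Fin r), φ (A.map Fin.castSuccEmb) +
      ∑ A : Finset (Fin r), φ (insert (Fin.last r) (A.map Fin.castSuccEmb)) := by
  have h : (Finset.univ : Finset (Fin (r + 1))) =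
      insert (Fin.last r) (Finset.univ.map Fin.castSuccEmb) := by
    rw [Fin.univ_castSuccEmb, Finset.cons_eq_insert]
  have hpow : ∀ ψ : Finset (Fin (r + 1)) → M,
      ∑ A ∈ (Finset.univ.map (Fin.castSuccEmb (n := r))).powerset, ψ A =
        ∑ A : Finset (Fin r), ψ (A.map Fin.castSuccEmb) := by
    intro ψ
    have : (Finset.univ.map (Fin.castSuccEmb (n := r))).powerset =
        Finset.univ.map (Finset.mapEmbedding (Fin.castSuccEmb (n := r))).toEmbedding := by
      ext A
      simp [Finset.subset_map_iff, eq_comm]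
    rw [this, Finset.sum_map]
    rfl
  rw [← Finset.powerset_univ, h, Finset.sum_powerset_insert (by simp [Fin.castSucc_ne_last]),
    hpow, hpow]

theorem koszulSign_eq {r : ℕ} (a : Fin r → ℤ) (A : Finset (Fin r)) :
    koszulSign a A = (∑ i ∈ A, ∑ j ∈ Aᶜ with j < i, a i * a j).negOnePow := by
  simp only [koszulSign, prod_negOnePow]

/-- A pair with one index in A and the other in the complement is inverted by exactly one of the two
unshuffles, so the product counts every such pair once. -/
theorem koszulSign_mul_compl {r : ℕ} (a : Fin r → ℤ) (A : Finset (Fin r)) :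
    koszulSign a A * koszulSign a Aᶜ = ((∑ i ∈ A, a i) * ∑ i ∈ Aᶜ, a i).negOnePow := by
  rw [koszulSign_eq, koszulSign_eq, ← Int.negOnePow_add, compl_compl, Finset.sum_mul_sum]
  congr 1
  have h : ∑ i ∈ Aᶜ, ∑ j ∈ A with j < i, a i * a j = ∑ i ∈ A, ∑ j ∈ Aᶜ with i < j, a i * a j := by
    simp only [Finset.sum_filter]
    rw [Finset.sum_comm]
    simp only [mul_comm]
  rw [h, ← Finset.sum_add_distrib]
  refine Finset.sum_congr rfl fun i hi => ?_
  rw [← Finset.sum_filter_add_sum_filter_not Aᶜ (fun j => j < i)]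
  congr 1
  refine Finset.sum_congr (Finset.filter_congr fun j hj => ?_) fun _ _ => rfl
  have : i ≠ j := fun h => Finset.mem_compl.1 hj (h ▸ hi)
  simp only [not_lt]
  exact ⟨le_of_lt, fun h => lt_of_le_of_ne h this⟩

theorem koszulSign_map_castSucc {r : ℕ} (a : Fin r → ℤ) (b : ℤ) (A : Finset (Fin r)) :
    koszulSign (Fin.snoc (α := fun _ => ℤ) a b) (A.map Fin.castSuccEmb) = koszulSign a A := by
  rw [koszulSign_eq, koszulSign_eq, Finset.sum_map]
  congr 1
  refine Finset.sum_congr rfl fun i _ => ?_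
  have : (A.map Fin.castSuccEmb)ᶜ.filter (fun j => j < Fin.castSuccEmb i) =
      (Aᶜ.filter fun j => j < i).map Fin.castSuccEmb := by
    ext j
    rw [Finset.mem_filter]
    refine Fin.lastCases ?_ (fun j => ?_) j <;>
      simp [Fin.castSucc_ne_last, (Fin.castSucc_lt_last i).le]
  rw [this, Finset.sum_map]
  simp

theorem koszulSign_insert_last {r : ℕ} (a : Fin r → ℤ) (b : ℤ) (A : Finset (Fin r)) :
    koszulSign (Fin.snoc (α := fun _ => ℤ) a b) (insert (Fin.last r) (A.map Fin.castSuccEmb)) =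
      (b * ∑ j ∈ Aᶜ, a j).negOnePow * koszulSign a A := by
  have hc : (insert (Fin.last r) (A.map Fin.castSuccEmb))ᶜ = Aᶜ.map Fin.castSuccEmb := by
    ext j
    refine Fin.lastCases ?_ (fun j => ?_) j <;> simp [Fin.castSucc_ne_last]
  rw [koszulSign_eq, koszulSign_eq, Finset.sum_insert (by simp [Fin.castSucc_ne_last]),
    Finset.sum_map, ← Int.negOnePow_add, hc]
  simp only [Finset.filter_map, Finset.sum_map]
  congr 2
  · rw [Finset.mul_sum, Finset.filter_true_of_mem]
    · simp
    · intro x _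
      simp [Fin.castSucc_lt_last]
  · refine Finset.sum_congr rfl fun i _ => ?_
    refine Finset.sum_congr (Finset.filter_congr fun j _ => ?_) fun j _ => ?_ <;> simp

/-- In an unshuffle the last argument w is either the last one left outside X, at no cost, or the
last one fed to X, at the cost of passing all arguments indexed by the complement of A. -/
theorem derivAlong_snoc (F : FormalMap k V W) (X : FormalMap k V V) {r : ℕ} (a : Fin r → ℤ)
    (v : Fin r → V) (b : ℤ) (w : V) :
    derivAlong F X (Fin.snoc (α := fun _ => ℤ) a b) (Fin.snoc (α := fun _ => V) v w) =
    ∑ A : Finset (Fin r), koszulSign a A • F (Aᶜ.card + 1 + 1)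
      (Fin.snoc (α := fun _ => V)
        (Fin.cons (X A.card (v ∘ A.orderEmbOfFin rfl)) (v ∘ Aᶜ.orderEmbOfFin rfl)) w) +
    ∑ A : Finset (Fin r), ((b * ∑ j ∈ Aᶜ, a j).negOnePow * koszulSign a A) • F (Aᶜ.card + 1)
      (Fin.cons (X (A.card + 1) (Fin.snoc (α := fun _ => V) (v ∘ A.orderEmbOfFin rfl) w))
        (v ∘ Aᶜ.orderEmbOfFin rfl)) := by
  have hcast : ∀ B : Finset (Fin r), StrictMono (Fin.castSucc ∘ B.orderEmbOfFin rfl) :=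
    fun B => Fin.strictMono_castSucc.comp (B.orderEmbOfFin rfl).strictMono
  have hlast : ∀ B : Finset (Fin r), StrictMono
      (Fin.snoc (α := fun _ => Fin (r + 1)) (Fin.castSucc ∘ B.orderEmbOfFin rfl) (Fin.last r)) := by
    intro B i j hij
    induction j using Fin.lastCases with
    | last =>
      induction i using Fin.lastCases with
      | last => exact absurd hij (lt_irrefl _)
      | cast i => simp [Fin.castSucc_lt_last]
    | cast j =>
      induction i using Fin.lastCases with
      | last => exact absurd hij (not_lt.2 (Fin.le_last _))
      | cast i => simpa using hij
  have hrange : ∀ (B : Finset (Fin r)) i, i ∈ B ↔ ∃ x, B.orderEmbOfFin rfl x = i := fun B i => by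
    rw [← Set.mem_range, Finset.range_orderEmbOfFin, Finset.mem_coe]
  have hsnoc : ∀ {p : ℕ} (e : Fin p → Fin r),
      Fin.snoc (α := fun _ => V) v w ∘ Fin.castSucc ∘ e = v ∘ e := fun e => by
    ext i
    simp
  have hsnoc' : ∀ {p : ℕ} (e : Fin p → Fin r), Fin.snoc (α := fun _ => V) v w ∘
      Fin.snoc (α := fun _ => Fin (r + 1)) (Fin.castSucc ∘ e) (Fin.last r) =
        Fin.snoc (α := fun _ => V) (v ∘ e) w := fun e => by
    ext i
    induction i using Fin.lastCases <;> simp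
  rw [derivAlong, sum_finset_fin_succ]
  congr 1
  · refine Finset.sum_congr rfl fun A _ => ?_
    rw [koszulSign_map_castSucc, derivAlong_term_eq F X _ _ (Fin.castSucc ∘ A.orderEmbOfFin rfl)
      (Fin.snoc (α := fun _ => Fin (r + 1)) (Fin.castSucc ∘ Aᶜ.orderEmbOfFin rfl) (Fin.last r))
      (hcast A) (hlast Aᶜ), hsnoc, hsnoc', Fin.cons_snoc_eq_snoc_cons]
    · intro i
      induction i using Fin.lastCases with
      | last => simp [Fin.castSucc_ne_last]
      | cast i => simp [hrange A i]
    · intro i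
      rw [Fin.range_snoc]
      induction i using Fin.lastCases with
      | last => simp [Fin.castSucc_ne_last]
      | cast i => simp [← hrange Aᶜ i, Fin.castSucc_ne_last]
  · refine Finset.sum_congr rfl fun A _ => ?_
    rw [koszulSign_insert_last, derivAlong_term_eq F X _ _
      (Fin.snoc (α := fun _ => Fin (r + 1)) (Fin.castSucc ∘ A.orderEmbOfFin rfl) (Fin.last r))
      (Fin.castSucc ∘ Aᶜ.orderEmbOfFin rfl) (hlast A) (hcast Aᶜ), hsnoc, hsnoc']
    · intro i
      rw [Fin.range_snoc]
      induction i using Fin.lastCases with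
      | last => simp [Fin.castSucc_ne_last]
      | cast i => simp [hrange A i, Fin.castSucc_ne_last]
    · intro i
      induction i using Fin.lastCases with
      | last => simp [Fin.castSucc_ne_last]
      | cast i => simp [← hrange Aᶜ i, Fin.castSucc_ne_last]

/-! ### The action functional -/

section Action

variable {n : ℤ} {𝒱 : ℤ → Submodule k V} {Q : FormalMap k V V} {ω : LinearMap.BilinForm k V}

theorem actionFunctional_snoc {r : ℕ} (v : Fin r → V) (w : V) :
    actionFunctional ω Q (r + 1) (Fin.snoc (α := fun _ => V) v w) = ω (Q r v) w := by
  simp [actionFunctional]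

theorem actionFunctional_succ {r : ℕ} (v : Fin (r + 1) → V) :
    actionFunctional ω Q (r + 1) v = ω (Q r (Fin.init v)) (v (Fin.last r)) := rfl

theorem IsShiftedSymplectic.apply_snoc_eq_smul (hω : IsShiftedSymplectic n 𝒱 Q ω)
    {r : ℕ} {a : Fin r → ℤ} {v : Fin r → V}
    (hv : ∀ l, v l ∈ 𝒱 (a l)) {i j : ℤ} {x y : V} (hx : x ∈ 𝒱 i) (hy : y ∈ 𝒱 j) :
    ω x (Q (r + 1) (Fin.snoc v y)) =
      (1 + i * (∑ l, a l + 1)).negOnePow • ω (Q (r + 1) (Fin.snoc v x)) y := by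
  have h := eq_neg_of_add_eq_zero_left (hω.lie_derivative r a v hv i j x hx y hy)
  rw [h, neg_eq_negOnePow_smul, negOnePow_smul_smul, negOnePow_smul_smul]
  rw [Int.negOnePow_even _ ⟨1 + i * (∑ l, a l + 1), by ring⟩, one_smul]

/-- Exchanges away from the last slot are the symmetry of Q. Exchanging the last two arguments is
where 𝓛_Q ω = 0 enters, combined with the antisymmetry of ω. -/
theorem isGradedFormalMap_actionFunctional (hQ : IsGradedFormalMap 𝒱 𝒱 1 Q)
    (hω : IsShiftedSymplectic n 𝒱 Q ω) :
    IsGradedFormalMap 𝒱 (scalarGrading k) (n + 1) (actionFunctional ω Q) where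
  degree := by
    rintro (_ | r) a v hv
    · exact Submodule.zero_mem _
    rw [actionFunctional_succ, Fin.sum_univ_castSucc]
    have h := hQ.degree r (fun i => a i.castSucc) (Fin.init v) fun i => hv _
    rw [scalarGrading]
    split_ifs with hd
    · trivial
    · exact hω.degree _ _ _ h _ (hv _) (by omega)
  symm := by
    rintro (_ | r) a v hv i j hij
    · exact i.elim0
    rw [actionFunctional_succ, actionFunctional_succ]
    have hinit : ∀ l : Fin r, Fin.init (α := fun _ => V) v l ∈ 𝒱 (a l.castSucc) := fun l => hv _
    induction j using Fin.lastCases with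
    | cast j =>
      obtain ⟨i, rfl⟩ : ∃ i' : Fin r, i = i'.castSucc :=
        ⟨⟨i, by simp at hij; omega⟩, rfl⟩
      have h1 : Fin.init (α := fun _ => V) (v ∘ Equiv.swap i.castSucc j.castSucc) =
          Fin.init (α := fun _ => V) v ∘ Equiv.swap i j := by
        funext l
        simp only [Fin.init, Function.comp_apply]
        rw [(Fin.castSucc_injective r).map_swap]
      have h2 : Equiv.swap i.castSucc j.castSucc (Fin.last r) = Fin.last r :=
        Equiv.swap_apply_of_ne_of_ne (Fin.castSucc_ne_last i).symm (Fin.castSucc_ne_last j).symm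
      rw [h1, hQ.symm r _ _ hinit i j (by simpa using hij), Function.comp_apply, h2]
      exact map_units_smul (ω.flip (v (Fin.last r))) _ _
    | last =>
      obtain ⟨r, rfl⟩ : ∃ r', r = r' + 1 := ⟨i, by simpa using hij.symm⟩
      obtain rfl : i = (Fin.last r).castSucc := by
        ext
        simpa using hij
      set x := v (Fin.last r).castSucc with hx
      set y := v (Fin.last (r + 1)) with hy
      let v' : Fin r → V := fun l => v l.castSucc.castSucc
      have h1 : Fin.init (α := fun _ => V) v = Fin.snoc (α := fun _ => V) v' x := by
        funext l
        induction l using Fin.lastCases <;> simp [Fin.init, v', hx]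
      have h2 : Fin.init (α := fun _ => V)
          (v ∘ Equiv.swap (Fin.last r).castSucc (Fin.last (r + 1))) =
            Fin.snoc (α := fun _ => V) v' y := by
        funext l
        induction l using Fin.lastCases with
        | last => simp [Fin.init, hy]
        | cast l =>
          simp only [Fin.init, Function.comp_apply, Fin.snoc_castSucc, v']
          rw [Equiv.swap_apply_of_ne_of_ne]
          · exact fun h => Fin.castSucc_ne_last l (Fin.castSucc_injective _ h)
          · exact Fin.castSucc_ne_last _
      rw [h1, h2, Function.comp_apply, Equiv.swap_apply_right, ← hx]
      have hv' : ∀ l, v' l ∈ 𝒱 (a l.castSucc.castSucc) := fun l => hv _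
      have hx' : x ∈ 𝒱 (a (Fin.last r).castSucc) := hv _
      have hy' : y ∈ 𝒱 (a (Fin.last (r + 1))) := hv _
      have hQy : Q (r + 1) (Fin.snoc v' y) ∈
          𝒱 (∑ l : Fin r, a l.castSucc.castSucc + a (Fin.last (r + 1)) + 1) := by
        have := hQ.degree (r + 1) (Fin.snoc (α := fun _ => ℤ) (fun l => a l.castSucc.castSucc)
          (a (Fin.last (r + 1)))) (Fin.snoc v' y) fun l => by
            induction l using Fin.lastCases <;> simp [hv', hy']
        simpa [Fin.sum_univ_castSucc] using this
      rw [hω.antisymm _ _ _ hQy _ hx', hω.apply_snoc_eq_smul hv' hx' hy',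
        neg_eq_negOnePow_smul, negOnePow_smul_smul, negOnePow_smul_smul]
      congr 1
      apply negOnePow_congr
      generalize a (Fin.last r).castSucc = p
      generalize a (Fin.last (r + 1)) = q
      generalize ∑ l : Fin r, a l.castSucc.castSucc = s
      exact ⟨1 + p * s + p, by ring⟩

/-- The classical master equation `{S, S} = 0`. -/
theorem derivAlong_actionFunctional (hQ : IsFormalModuliProblem 𝒱 Q)
    (hω : IsShiftedSymplectic n 𝒱 Q ω) {r : ℕ} (a : Fin r → ℤ) (v : Fin r → V)
    (hv : ∀ i, v i ∈ 𝒱 (a i)) : derivAlong (actionFunctional ω Q) Q a v = 0 := by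
  obtain _ | r := r
  -- The constant term has no last argument to split off; it vanishes because Q vanishes at the
  -- origin.
  · rw [derivAlong, Fintype.sum_eq_single ∅ (fun A hA => (hA (Finset.eq_empty_of_isEmpty A)).elim)]
    rw [derivAlong_term_eq _ _ v ∅ (p := 0) (q := 0) Fin.elim0 Fin.elim0 (fun i => i.elim0)
      (fun i => i.elim0) (fun i => i.elim0) (fun i => i.elim0), hQ.pointed]
    rw [MultilinearMap.map_coord_zero _ 0 (by simp), smul_zero]
  obtain ⟨a, b, rfl⟩ : ∃ a' b, a = Fin.snoc (α := fun _ => ℤ) a' b :=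
    ⟨Fin.init a, a (Fin.last r), (Fin.snoc_init_self a).symm⟩
  obtain ⟨v, w, rfl⟩ : ∃ v' w, v = Fin.snoc (α := fun _ => V) v' w :=
    ⟨Fin.init v, v (Fin.last r), (Fin.snoc_init_self v).symm⟩
  have hv' : ∀ i, v i ∈ 𝒱 (a i) := fun i => by simpa using hv i.castSucc
  have hw : w ∈ 𝒱 b := by simpa using hv (Fin.last r)
  have hmem : ∀ (A : Finset (Fin r)) i,
      (v ∘ A.orderEmbOfFin rfl) i ∈ 𝒱 (a (A.orderEmbOfFin rfl i)) :=
    fun A i => hv' _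
  have hsum : ∀ A : Finset (Fin r), ∑ i, a (A.orderEmbOfFin rfl i) = ∑ i ∈ A, a i := fun A => by
    conv_rhs => rw [← Finset.map_orderEmbOfFin_univ A rfl, Finset.sum_map]
    rfl
  have hQA : ∀ A : Finset (Fin r),
      Q A.card (v ∘ A.orderEmbOfFin rfl) ∈ 𝒱 (∑ i ∈ A, a i + 1) := fun A => by
    rw [← hsum]
    exact hQ.graded.degree _ _ _ (hmem A)
  have hS := isGradedFormalMap_actionFunctional hQ.graded hω
  have h1 : ∑ A : Finset (Fin r), koszulSign a A • actionFunctional ω Q (Aᶜ.card + 1 + 1)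
      (Fin.snoc (α := fun _ => V)
        (Fin.cons (Q A.card (v ∘ A.orderEmbOfFin rfl)) (v ∘ Aᶜ.orderEmbOfFin rfl)) w) =
      ω (derivAlong Q Q a v) w := by
    rw [derivAlong, map_sum, LinearMap.sum_apply]
    refine Finset.sum_congr rfl fun A _ => ?_
    rw [actionFunctional_snoc]
    exact (map_units_smul (ω.flip w) _ _).symm
  -- Symmetry of S moves Q(v_A, w) to the last slot, and 𝓛_Q ω = 0 moves this Q across ω, giving
  -- ω(Q(Q(v_{Aᶜ}), v_A), w) up to sign. The sets A and Aᶜ have changed roles, so the sum is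
  -- reindexed by complement.
  have h2 : ∑ A : Finset (Fin r), ((b * ∑ j ∈ Aᶜ, a j).negOnePow * koszulSign a A) •
      actionFunctional ω Q (Aᶜ.card + 1)
      (Fin.cons (Q (A.card + 1) (Fin.snoc (α := fun _ => V) (v ∘ A.orderEmbOfFin rfl) w))
        (v ∘ Aᶜ.orderEmbOfFin rfl)) = ω (derivAlong Q Q a v) w := by
    rw [derivAlong, map_sum, LinearMap.sum_apply]
    refine Fintype.sum_equiv (Equiv.ofBijective compl compl_bijective) _ _ fun A => ?_
    have hQw : Q (A.card + 1) (Fin.snoc (α := fun _ => V) (v ∘ A.orderEmbOfFin rfl) w) ∈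
        𝒱 (∑ i ∈ A, a i + b + 1) := by
      have := hQ.graded.degree (A.card + 1)
        (Fin.snoc (α := fun _ => ℤ) (fun i => a (A.orderEmbOfFin rfl i)) b)
        (Fin.snoc (v ∘ A.orderEmbOfFin rfl) w) fun l => by
          induction l using Fin.lastCases with
          | last => simpa using hw
          | cast l => simpa using hv' _
      simpa [Fin.sum_univ_castSucc, hsum] using this
    have hcc : Q (Aᶜᶜ.card + 1) (Fin.cons (Q Aᶜ.card (v ∘ Aᶜ.orderEmbOfFin rfl))
        (v ∘ Aᶜᶜ.orderEmbOfFin rfl)) =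
        Q (A.card + 1) (Fin.cons (Q Aᶜ.card (v ∘ Aᶜ.orderEmbOfFin rfl))
        (v ∘ A.orderEmbOfFin rfl)) := by
      rw [compl_compl]
    have hsign : koszulSign a Aᶜ =
        ((∑ i ∈ A, a i) * ∑ i ∈ Aᶜ, a i).negOnePow * koszulSign a A := by
      rw [← koszulSign_mul_compl, mul_comm (koszulSign a A), mul_assoc, Int.units_mul_self, mul_one]
    refine Eq.trans ?_ (congrArg (fun x => ω (koszulSign a Aᶜ • x) w) hcc.symm)
    rw [hS.apply_cons (hmem Aᶜ) hQw, actionFunctional_snoc,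
      hω.apply_snoc_eq_smul (hmem A) (hQA Aᶜ) hw,
      hQ.graded.apply_cons (hmem A) (hQA Aᶜ), hsign, hsum, hsum, koszulSign_eq]
    rw [← Int.negOnePow_add, ← Int.negOnePow_add, negOnePow_smul_smul, negOnePow_smul_smul,
      negOnePow_smul_smul]
    refine Eq.trans ?_ (map_units_smul (ω.flip w) _ _).symm
    exact congrArg (fun ε : ℤˣ => ε • ω _ w)
      (negOnePow_congr ⟨b * (∑ i ∈ Aᶜ, a i) + (∑ i ∈ Aᶜ, a i) + 1, by ring⟩)
  rw [derivAlong_snoc, h1, h2, hQ.square_zero r a v hv', map_zero, LinearMap.zero_apply, add_zero]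

end Action

/-! ### Transport along a linear isomorphism -/

section Transport

variable {T : Type*} [AddCommGroup T] [Module k T] {𝒲 : ℤ → Submodule k W} {𝒯 : ℤ → Submodule k T}
  {X : FormalMap k W W} {Q : FormalMap k T T} (e : W ≃ₗ[k] T)

theorem isInternal_of_linearEquiv (he : ∀ i x, x ∈ 𝒲 i ↔ e x ∈ 𝒯 i)
    (h : DirectSum.IsInternal 𝒯) : DirectSum.IsInternal 𝒲 := by
  rw [DirectSum.isInternal_submodule_iff_iSupIndep_and_iSup_eq_top] at h ⊢
  have h𝒲 : 𝒲 = (Submodule.orderIsoMapComap e).symm ∘ 𝒯 := by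
    funext i
    ext x
    exact he i x
  constructor
  · rw [h𝒲]
    exact h.1.map_orderIso _
  · have := (Submodule.orderIsoMapComap e).symm.map_iSup 𝒯
    rw [h.2, map_top] at this
    rw [h𝒲]
    exact this.symm

theorem IsFormalModuliProblem.of_linearEquiv (hQ : IsFormalModuliProblem 𝒯 Q)
    (he : ∀ i x, x ∈ 𝒲 i ↔ e x ∈ 𝒯 i) (hX : ∀ r v, e (X r v) = Q r fun i => e (v i)) :
    IsFormalModuliProblem 𝒲 X where
  grading := isInternal_of_linearEquiv e he hQ.grading
  graded :=
    { degree := fun r a v hv => by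
        rw [he, hX]
        exact hQ.graded.degree r a _ fun i => (he _ _).1 (hv i)
      symm := fun r a v hv i j hij => e.injective <| by
        refine Eq.trans ?_ (map_units_smul e.toLinearMap _ _).symm
        rw [LinearEquiv.coe_coe, hX, hX]
        exact hQ.graded.symm r a (fun i => e (v i)) (fun i => (he _ _).1 (hv i)) i j hij }
  pointed := by
    ext v
    apply e.injective
    rw [hX, hQ.pointed]
    simp
  square_zero := fun r a v hv => e.injective <| by
    rw [map_zero]
    exact (map_derivAlong e.toLinearMap e.toLinearMap hX hX a v).trans
      (hQ.square_zero r a _ fun i => (he _ _).1 (hv i))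

theorem IsShiftedSymplectic.of_linearEquiv {n : ℤ} {ω : LinearMap.BilinForm k T}
    {ω' : LinearMap.BilinForm k W} (hω : IsShiftedSymplectic n 𝒯 Q ω)
    (he : ∀ i x, x ∈ 𝒲 i ↔ e x ∈ 𝒯 i) (hX : ∀ r v, e (X r v) = Q r fun i => e (v i))
    (hω' : ∀ x y, ω (e x) (e y) = ω' x y) (hnd : ω'.Nondegenerate) :
    IsShiftedSymplectic n 𝒲 X ω' where
  degree i j x hx y hy hij := by
    rw [← hω']
    exact hω.degree i j _ ((he _ _).1 hx) _ ((he _ _).1 hy) hij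
  antisymm i j x hx y hy := by
    rw [← hω', ← hω']
    exact hω.antisymm i j _ ((he _ _).1 hx) _ ((he _ _).1 hy)
  nondegenerate := hnd
  lie_derivative r a v hv i j x hx y hy := by
    have hsnoc : ∀ z, (fun l => e (Fin.snoc (α := fun _ => W) v z l)) =
        Fin.snoc (α := fun _ => T) (fun l => e (v l)) (e z) := fun z => by
      funext l
      induction l using Fin.lastCases <;> simp
    rw [← hω', ← hω', hX, hX, hsnoc, hsnoc]
    exact hω.lie_derivative r a _ (fun l => (he _ _).1 (hv l)) i j _ ((he _ _).1 hx) _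
      ((he _ _).1 hy)

end Transport

/-! ### Weights -/

section Weight

variable {n : ℤ} {𝒱 : ℤ → Submodule k V}

theorem weightPart_apply (j : ℕ) (F : FormalMap k (V × Module.Dual k V) k) {r : ℕ}
    (u : Fin r → V × Module.Dual k V) :
    weightPart j F r u = ∑ B ∈ (Finset.univ : Finset (Fin r)).powersetCard j,
      F r fun i => if i ∈ B then (0, (u i).2) else ((u i).1, 0) := by
  rw [weightPart, sum_apply]
  refine Finset.sum_congr rfl fun B _ => ?_
  rw [MultilinearMap.compLinearMap_apply]
  congr 1
  funext i
  split_ifs <;> simp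

theorem sum_weightPart (F : FormalMap k (V × Module.Dual k V) k) (r : ℕ) :
    ∑ j ∈ Finset.range (r + 1), weightPart j F r = F r := by
  ext u
  -- Multilinear expansion gives one term for each set of covector slots; these are then grouped by
  -- cardinality.
  have hu : u = (fun i => ((0 : V), (u i).2)) + fun i => ((u i).1, (0 : Module.Dual k V)) := by
    funext i
    simp
  conv_rhs => rw [hu, MultilinearMap.map_add_univ, ← Finset.powerset_univ, Finset.sum_powerset]
  rw [sum_apply, Finset.card_univ, Fintype.card_fin]
  refine Finset.sum_congr rfl fun j _ => ?_
  rw [weightPart_apply]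
  rfl

theorem weightPart_add_weightGeTwo (F : FormalMap k (V × Module.Dual k V) k) :
    weightPart 0 F + weightPart 1 F + weightGeTwo F = F := by
  funext r
  rw [Pi.add_apply, Pi.add_apply, weightGeTwo]
  conv_rhs => rw [← sum_weightPart F r]
  -- For r = 0 the sum over weights stops at 0, so the extra term of weight 1 has to be seen to
  -- vanish.
  obtain _ | r := r
  · have : weightPart 1 F 0 = 0 := by
      rw [weightPart, Finset.powersetCard_eq_empty.2 (by simp), Finset.sum_empty]
    simp [this]
  · have : Finset.range (r + 1 + 1) = insert 0 (insert 1 (Finset.Icc 2 (r + 1))) := by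
      ext j
      simp
      omega
    rw [this, Finset.sum_insert (by simp), Finset.sum_insert (by simp), add_assoc]

/-- By pigeonhole, any choice of j covector slots includes one outside B, where the covector
component is zero. -/
theorem weightPart_apply_of_card_lt {i j : ℕ} (h : i < j)
    (F : FormalMap k (V × Module.Dual k V) k) (r : ℕ) (u : Fin r → V × Module.Dual k V)
    (B : Finset (Fin r)) (hB : B.card = i) :
    weightPart j F r (fun l => if l ∈ B then (0, (u l).2) else ((u l).1, 0)) = 0 := by
  rw [weightPart_apply]
  refine Finset.sum_eq_zero fun B' hB' => ?_
  obtain ⟨l, hl, hlB⟩ := Finset.exists_mem_notMem_of_card_lt_card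
    (by rw [hB, (Finset.mem_powersetCard.1 hB').2]; exact h : B.card < B'.card)
  exact MultilinearMap.map_coord_zero _ l (by simp [hl, hlB])

theorem weightPart_weightGeTwo {i : ℕ} (h : i < 2) (F : FormalMap k (V × Module.Dual k V) k) :
    weightPart i (weightGeTwo F) = 0 := by
  funext r
  ext u
  rw [weightPart_apply]
  refine Finset.sum_eq_zero fun B hB => ?_
  rw [weightGeTwo, sum_apply]
  refine Finset.sum_eq_zero fun j hj => ?_
  exact weightPart_apply_of_card_lt (by have := Finset.mem_Icc.1 hj; omega) F r u B
    (Finset.mem_powersetCard.1 hB).2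

theorem IsGradedFormalMap.weightPart {𝒲 : ℤ → Submodule k k} {d : ℤ}
    {F : FormalMap k (V × Module.Dual k V) k}
    (hF : IsGradedFormalMap (cotangentGrading n 𝒱) 𝒲 d F) (j : ℕ) :
    IsGradedFormalMap (cotangentGrading n 𝒱) 𝒲 d (weightPart j F) := by
  classical
  have hmem : ∀ {r : ℕ} {a : Fin r → ℤ} {u : Fin r → V × Module.Dual k V} (B : Finset (Fin r)),
      (∀ i, u i ∈ cotangentGrading n 𝒱 (a i)) → ∀ i,
      (if i ∈ B then (0, (u i).2) else ((u i).1, 0)) ∈ cotangentGrading n 𝒱 (a i) := by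
    intro r a u B hu i
    have := Submodule.mem_prod.1 (hu i)
    split_ifs
    · exact Submodule.mem_prod.2 ⟨Submodule.zero_mem _, this.2⟩
    · exact Submodule.mem_prod.2 ⟨this.1, Submodule.zero_mem _⟩
  constructor
  · intro r a u hu
    rw [weightPart_apply]
    exact Submodule.sum_mem _ fun B _ => hF.degree r a _ (hmem B hu)
  · intro r a u hu i l hil
    rw [weightPart_apply, weightPart_apply, Finset.smul_sum]
    -- The transposition permutes the sets of covector slots of fixed cardinality.
    refine Finset.sum_equiv (Equiv.finsetCongr (Equiv.swap i l)) (fun B => ?_) fun B _ => ?_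
    · simp [Finset.mem_powersetCard]
    · rw [← hF.symm r a _ (hmem _ hu) i l hil]
      congr 1
      funext m
      simp

theorem IsGradedFormalMap.weightGeTwo {𝒲 : ℤ → Submodule k k} {d : ℤ}
    {F : FormalMap k (V × Module.Dual k V) k}
    (hF : IsGradedFormalMap (cotangentGrading n 𝒱) 𝒲 d F) :
    IsGradedFormalMap (cotangentGrading n 𝒱) 𝒲 d (weightGeTwo F) where
  degree r a u hu := by
    rw [ShiftedPoisson.weightGeTwo, sum_apply]
    exact Submodule.sum_mem _ fun j _ => (hF.weightPart j).degree r a u hu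
  symm r a u hu i l hil := by
    rw [ShiftedPoisson.weightGeTwo, sum_apply, sum_apply,
      Finset.smul_sum]
    exact Finset.sum_congr rfl fun j _ => (hF.weightPart j).symm r a u hu i l hil

end Weight

/-! ### Fibrewise linear functions on the cotangent bundle -/

section LinearHamiltonian

variable (n : ℤ) (𝒱 : ℤ → Submodule k V) [DirectSum.Decomposition 𝒱]

theorem parityProj_of_mem (e : Fin 2) {i : ℤ} {v : V} (hv : v ∈ 𝒱 i) :
    parityProj 𝒱 e v = if i % 2 = ((e : ℕ) : ℤ) then v else 0 := by
  simp only [parityProj, LinearMap.comp_apply, LinearEquiv.coe_coe,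
    DirectSum.decomposeLinearEquiv_apply, DirectSum.decompose_of_mem 𝒱 hv]
  rw [← DirectSum.lof_eq_of k, DirectSum.toModule_lof]
  split_ifs <;> rfl

theorem linearHamiltonian_apply (Q : FormalMap k V V) {r : ℕ}
    {a : Fin (r + 1) → ℤ} {u : Fin (r + 1) → V × Module.Dual k V} (hu : ∀ i, (u i).1 ∈ 𝒱 (a i)) :
    linearHamiltonian n 𝒱 Q (r + 1) u =
      ∑ i : Fin (r + 1), ((n + 1 + ∑ j, a (i.succAbove j)) *
        ∑ j with i ≤ Fin.castSucc j, a (i.succAbove j)).negOnePow •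
          (u i).2 (Q r fun j => (u (i.succAbove j)).1) := by
  simp only [linearHamiltonian, sum_apply]
  refine Finset.sum_congr rfl fun i _ => ?_
  -- Only the parities of the actual degrees survive the projections, and the sign depends on
  -- parities alone.
  let e₀ : Fin r → Fin 2 := fun j => ⟨(a (i.succAbove j) % 2).toNat, by omega⟩
  have he₀ : ∀ j, ((e₀ j : ℕ) : ℤ) = a (i.succAbove j) % 2 := fun j => by
    simp only [e₀]
    omega
  rw [Fintype.sum_eq_single e₀]
  · rw [smul_apply]
    have hval : ∀ j, parityProj 𝒱 (e₀ j) (u (i.succAbove j)).1 = (u (i.succAbove j)).1 := fun j => by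
      rw [parityProj_of_mem 𝒱 _ (hu _), if_pos (he₀ j).symm]
    have hpar : ∀ s : Finset (Fin r), Even (∑ j ∈ s, ((e₀ j : ℕ) : ℤ) -
        ∑ j ∈ s, a (i.succAbove j)) := fun s => by
      rw [← Finset.sum_sub_distrib]
      refine Finset.even_sum _ fun j _ => ?_
      rw [he₀, Int.even_iff]
      omega
    congr 1
    · apply negOnePow_congr
      obtain ⟨c, hc⟩ := hpar Finset.univ
      obtain ⟨c', hc'⟩ := hpar (Finset.univ.filter fun j => i ≤ Fin.castSucc j)
      rw [sub_eq_iff_eq_add] at hc hc'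
      rw [hc, hc']
      generalize (∑ j, a (i.succAbove j)) = s
      generalize (∑ j with i ≤ Fin.castSucc j, a (i.succAbove j)) = t
      exact ⟨(n + 1 + s) * c' + c * t + 2 * c * c', by ring⟩
    · change (u i).2 (Q r fun j => parityProj 𝒱 (e₀ j) (u (i.succAbove j)).1) = _
      simp only [hval]
  · intro e he
    obtain ⟨j, hj⟩ := Function.ne_iff.1 he
    change (_ : ℤˣ) • (u i).2 (Q r fun j => parityProj 𝒱 (e j) (u (i.succAbove j)).1) = 0
    rw [MultilinearMap.map_coord_zero _ j, map_zero, smul_zero]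
    rw [parityProj_of_mem 𝒱 _ (hu _), if_neg]
    rw [← he₀]
    exact fun h => hj (Fin.ext (by exact_mod_cast h.symm))

end LinearHamiltonian

theorem mem_iInf_dualAnnihilator {n : ℤ} {𝒱 : ℤ → Submodule k V} {i : ℤ} {ξ : Module.Dual k V} :
    ξ ∈ (⨅ j : {j : ℤ // j ≠ -n - i}, (𝒱 j.1).dualAnnihilator) ↔
      ∀ j ≠ -n - i, ∀ a ∈ 𝒱 j, ξ a = 0 := by
  simp [Submodule.mem_iInf, Submodule.mem_dualAnnihilator]

theorem apply_hamiltonianVF [FiniteDimensional k V] (ω : LinearMap.BilinForm k V)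
    (hω : ω.Nondegenerate) (F : FormalMap k V k) {r : ℕ} (v : Fin r → V) (w : V) :
    ω (hamiltonianVF ω hω F r v) w = F (r + 1) (Fin.snoc v w) :=
  LinearMap.BilinForm.apply_toDual_symm_apply (hB := hω) _ _

theorem hamiltonianVF_add [FiniteDimensional k V] (ω : LinearMap.BilinForm k V)
    (hω : ω.Nondegenerate) (F G : FormalMap k V k) :
    hamiltonianVF ω hω F + hamiltonianVF ω hω G = hamiltonianVF ω hω (F + G) := by
  funext r
  ext v
  refine sub_eq_zero.1 (hω.1 _ fun w => ?_)
  rw [map_sub, LinearMap.sub_apply, apply_hamiltonianVF, Pi.add_apply, add_apply, map_add,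
    LinearMap.add_apply, apply_hamiltonianVF, apply_hamiltonianVF, Pi.add_apply, add_apply,
    sub_self]

/-! ### The splitting of a Lagrangian with an isotropic complement -/

section Splitting

variable {T : Type*} [AddCommGroup T] [Module k T] [FiniteDimensional k T]
  {n : ℤ} {𝒯 : ℤ → Submodule k T} [DirectSum.Decomposition 𝒯]
  {𝒱 : ℤ → Submodule k V} [DirectSum.Decomposition 𝒱]
  {Q : FormalMap k T T} {R : FormalMap k V V} {ω : LinearMap.BilinForm k T} {f : V →ₗ[k] T}
  {C : Submodule k T}

theorem splitting_inl (hnd : ω.Nondegenerate) (hL : IsRegularEmbeddedLagrangian ω f)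
    (hC : IsCompl (LinearMap.range f) C) (a : V) : splitting hnd hL hC (a, 0) = f a := by
  simp [splitting]

theorem splitting_inr_mem (hnd : ω.Nondegenerate) (hL : IsRegularEmbeddedLagrangian ω f)
    (hC : IsCompl (LinearMap.range f) C) (ξ : Module.Dual k V) :
    splitting hnd hL hC (0, ξ) ∈ C := by
  simp [splitting]

theorem apply_splitting_inr (hnd : ω.Nondegenerate) (hL : IsRegularEmbeddedLagrangian ω f)
    (hC : IsCompl (LinearMap.range f) C) (a : V) (ξ : Module.Dual k V) :
    ω (f a) (splitting hnd hL hC (0, ξ)) = ξ a := by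
  have h := LinearMap.congr_fun ((LinearEquiv.ofBijective (complementToDual ω f C)
    (complementToDual_bijective hnd hL hC)).apply_symm_apply ξ) a
  simp only [splitting, LinearMap.coprod_apply, map_zero, zero_add]
  exact h

theorem splitting_apply (hnd : ω.Nondegenerate) (hL : IsRegularEmbeddedLagrangian ω f)
    (hC : IsCompl (LinearMap.range f) C) (x : V × Module.Dual k V) :
    splitting hnd hL hC x = f x.1 + splitting hnd hL hC (0, x.2) := by
  rw [← splitting_inl hnd hL hC, ← map_add]
  simp

theorem splitting_surjective (hnd : ω.Nondegenerate) (hL : IsRegularEmbeddedLagrangian ω f)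
    (hC : IsCompl (LinearMap.range f) C) : Function.Surjective (splitting hnd hL hC) := by
  intro x
  obtain ⟨_, ⟨a, rfl⟩, w, hw, rfl⟩ := Submodule.mem_sup.1
    (hC.sup_eq_top ▸ Submodule.mem_top : x ∈ LinearMap.range f ⊔ C)
  refine ⟨(a, complementToDual ω f C ⟨w, hw⟩), ?_⟩
  have h := (LinearEquiv.ofBijective (complementToDual ω f C)
    (complementToDual_bijective hnd hL hC)).symm_apply_apply ⟨w, hw⟩
  rw [LinearEquiv.ofBijective_apply] at h
  simp [splitting, h]

/-- The splitting is symplectic. -/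
theorem apply_splitting_splitting (hω : IsShiftedSymplectic n 𝒯 Q ω) (hf : IsDegreeZero 𝒱 𝒯 f)
    (hL : IsRegularEmbeddedLagrangian ω f) (hC : IsIsotropicComplement 𝒯 ω f C)
    (x y : V × Module.Dual k V) :
    ω (splitting hω.nondegenerate hL hC.isCompl x) (splitting hω.nondegenerate hL hC.isCompl y) =
      cotangentForm n 𝒱 x y := by
  -- Graded antisymmetry of ω produces the sign twist in the second term of `cotangentForm`.
  have hflip : ∀ (ξ : Module.Dual k V) (b : V),
      ω (splitting hω.nondegenerate hL hC.isCompl (0, ξ)) (f b) =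
        -ξ (signTwist 𝒱 (n + 1) b) := by
    intro ξ
    have : ω (splitting hω.nondegenerate hL hC.isCompl (0, ξ)) ∘ₗ f =
        -(ξ ∘ₗ signTwist 𝒱 (n + 1)) := by
      refine linearMap_ext_homogeneous (𝒱 := 𝒱) fun i b hb => ?_
      rw [LinearMap.comp_apply, hω.apply_eq_neg_flip _ (hf i b hb), apply_splitting_inr,
        LinearMap.neg_apply, LinearMap.comp_apply, signTwist_of_mem 𝒱 _ hb, map_units_smul]
    exact fun b => LinearMap.congr_fun this b
  rw [splitting_apply _ _ _ x, splitting_apply _ _ _ y, map_add, map_add, LinearMap.add_apply,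
    LinearMap.add_apply, hL.isotropic, apply_splitting_inr, hflip,
    hC.isotropic _ (splitting_inr_mem _ _ _ _) _ (splitting_inr_mem _ _ _ _)]
  simp [cotangentForm, sub_eq_add_neg, add_comm]

/-- A map pulling ω back to a nondegenerate form has no kernel. -/
theorem splitting_injective (hω : IsShiftedSymplectic n 𝒯 Q ω) (hf : IsDegreeZero 𝒱 𝒯 f)
    (hL : IsRegularEmbeddedLagrangian ω f) (hC : IsIsotropicComplement 𝒯 ω f C) :
    Function.Injective (splitting hω.nondegenerate hL hC.isCompl) := by
  rw [injective_iff_map_eq_zero]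
  intro x hx
  refine (cotangentForm_nondegenerate n 𝒱).1 x fun y => ?_
  rw [← apply_splitting_splitting hω hf hL hC, hx, map_zero, LinearMap.zero_apply]

/-- The splitting identifies the gradings. -/
theorem mem_cotangentGrading_iff (hω : IsShiftedSymplectic n 𝒯 Q ω) (hf : IsDegreeZero 𝒱 𝒯 f)
    (hL : IsRegularEmbeddedLagrangian ω f) (hC : IsIsotropicComplement 𝒯 ω f C) (i : ℤ)
    (x : V × Module.Dual k V) : x ∈ cotangentGrading n 𝒱 i ↔
      splitting hω.nondegenerate hL hC.isCompl x ∈ 𝒯 i := by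
  -- The image of f and C are complementary graded subspaces, so in each degree other than j both
  -- components vanish separately.
  have hsplit : ∀ {j : ℤ} {a : V} {w : T}, w ∈ C → f a + w ∈ 𝒯 j → a ∈ 𝒱 j ∧ w ∈ 𝒯 j := by
    intro j a w hw h
    have hzero : ∀ l ≠ j, (DirectSum.decompose 𝒱 a l : V) = 0 ∧
        (DirectSum.decompose 𝒯 w l : T) = 0 := by
      intro l hl
      have h0 : f (DirectSum.decompose 𝒱 a l) + (DirectSum.decompose 𝒯 w l : T) = 0 := by
        rw [← coe_decompose_map hf, ← Submodule.coe_add, ← DirectSum.add_apply,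
          ← DirectSum.decompose_add, DirectSum.decompose_of_mem_ne _ h (Ne.symm hl)]
      have hwl : (DirectSum.decompose 𝒯 w l : T) ∈ C := hC.homogeneous l hw
      have hfl : f (DirectSum.decompose 𝒱 a l) = 0 := by
        refine Submodule.disjoint_def.1 hC.isCompl.disjoint _ ⟨_, rfl⟩ ?_
        rw [eq_neg_of_add_eq_zero_left h0]
        exact C.neg_mem hwl
      rw [hfl, zero_add] at h0
      exact ⟨hL.injective (hfl.trans (map_zero f).symm), h0⟩
    exact ⟨mem_of_forall_decompose_eq_zero fun l hl => (hzero l hl).1,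
      mem_of_forall_decompose_eq_zero fun l hl => (hzero l hl).2⟩
  rw [cotangentGrading, Submodule.mem_prod, mem_iInf_dualAnnihilator, splitting_apply]
  have hw := splitting_inr_mem hω.nondegenerate hL hC.isCompl x.2
  have hpair := fun a => apply_splitting_inr hω.nondegenerate hL hC.isCompl a x.2
  constructor
  · rintro ⟨h1, h2⟩
    -- The degree of the summand in C is detected by pairing; as C is isotropic, only the Lagrangian
    -- part of the test vector contributes.
    refine Submodule.add_mem _ (hf i _ h1) (hω.mem_of_forall_apply_eq_zero fun j hj y hy => ?_)
    rw [hω.apply_eq_zero_comm _ hy]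
    obtain ⟨_, ⟨a, rfl⟩, w, hw', rfl⟩ := Submodule.mem_sup.1
      (hC.isCompl.sup_eq_top ▸ Submodule.mem_top : y ∈ LinearMap.range f ⊔ C)
    rw [map_add, LinearMap.add_apply, hpair, hC.isotropic _ hw' _ hw,
      h2 j hj a (hsplit hw' hy).1, add_zero]
  · intro h
    obtain ⟨h1, h2⟩ := hsplit hw h
    refine ⟨h1, fun j hj a ha => ?_⟩
    rw [← hpair]
    exact hω.degree j i _ (hf j a ha) _ h2 (by omega)

/-- The action functional in the coordinates of the splitting. -/
theorem linearHamiltonian_add_inducedPoisson (hQ : IsFormalModuliProblem 𝒯 Q)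
    (hω : IsShiftedSymplectic n 𝒯 Q ω) (hR : IsGradedFormalMap 𝒱 𝒱 1 R)
    (hf : IsStrictMap 𝒱 R 𝒯 Q f) (hL : IsRegularEmbeddedLagrangian ω f)
    (hC : IsIsotropicComplement 𝒯 ω f C) :
    linearHamiltonian n 𝒱 R + inducedPoisson Q hω.nondegenerate hL hC.isCompl =
      fun r => (actionFunctional ω Q r).compLinearMap
        fun _ => splitting hω.nondegenerate hL hC.isCompl := by
  set Φ := splitting hω.nondegenerate hL hC.isCompl with hΦ
  have hgrad := mem_cotangentGrading_iff hω hf.degree hL hC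
  have hint : DirectSum.IsInternal (cotangentGrading n 𝒱) :=
    isInternal_of_linearEquiv (LinearEquiv.ofBijective Φ
      ⟨splitting_injective hω hf.degree hL hC, splitting_surjective _ _ _⟩) hgrad hQ.grading
  have hzero : weightPart 0 (fun r => (actionFunctional ω Q r).compLinearMap fun _ => Φ) = 0 := by
    funext r
    ext u
    obtain _ | r := r
    · rw [weightPart_apply]
      exact Finset.sum_eq_zero fun B _ => rfl
    · rw [weightPart_apply, Finset.powersetCard_zero, Finset.sum_singleton,
        MultilinearMap.compLinearMap_apply, actionFunctional_succ]
      simp only [Finset.notMem_empty, if_false, hΦ, splitting_inl]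
      change ω (Q r fun i => f (u i.castSucc).1) (f (u (Fin.last r)).1) = 0
      rw [← hf.comm, hL.isotropic]
  have hone : weightPart 1 (fun r => (actionFunctional ω Q r).compLinearMap fun _ => Φ) =
      linearHamiltonian n 𝒱 R := by
    funext r
    obtain _ | r := r
    · ext u
      rw [weightPart_apply]
      exact Finset.sum_eq_zero fun B _ => rfl
    refine multilinearMap_ext_homogeneous hint fun a u hu => ?_
    have hu1 : ∀ i, (u i).1 ∈ 𝒱 (a i) := fun i => (Submodule.mem_prod.1 (hu i)).1
    rw [linearHamiltonian_apply n 𝒱 R hu1, weightPart_apply, Finset.powersetCard_one,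
      Finset.sum_map]
    refine Finset.sum_congr rfl fun i _ => ?_
    have hins : (fun l => Φ (if l ∈ ({i} : Finset (Fin (r + 1))) then (0, (u l).2)
        else ((u l).1, 0))) = i.insertNth (α := fun _ => T) (Φ (0, (u i).2))
          fun j => f (u (i.succAbove j)).1 := by
      refine (Fin.insertNth_eq_iff.2 ⟨by simp, funext fun j => ?_⟩).symm
      simp [Fin.removeNth_apply, hΦ, splitting_inl]
    have hξ : Φ (0, (u i).2) ∈ 𝒯 (a i) := (hgrad _ _).1
      (Submodule.mem_prod.2 ⟨Submodule.zero_mem _, (Submodule.mem_prod.1 (hu i)).2⟩)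
    refine Eq.trans (congrArg (actionFunctional ω Q (r + 1)) hins) ?_
    rw [(isGradedFormalMap_actionFunctional hQ.graded hω).apply_insertNth
      (fun j => hf.degree _ _ (hu1 (i.succAbove j))) hξ, actionFunctional_snoc, ← hf.comm, hΦ,
      apply_splitting_inr]
    -- The two signs agree only when the degrees of ξ and R(…) match, where a i has the parity of n
    -- + 1 plus the other degrees. Otherwise ξ(R(…)) is zero.
    by_cases hd : ∑ j, a (i.succAbove j) + 1 = -n - a i
    · congr 1
      apply negOnePow_congr
      have : a i = -(n + 1 + ∑ j, a (i.succAbove j)) := by omega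
      rw [this]
      generalize (∑ j, a (i.succAbove j)) = s
      generalize (∑ j with i ≤ Fin.castSucc j, a (i.succAbove j)) = t
      exact ⟨-((n + 1 + s) * t), by ring⟩
    · have h0 : (u i).2 (R r fun j => (u (i.succAbove j)).1) = 0 :=
        mem_iInf_dualAnnihilator.1 (Submodule.mem_prod.1 (hu i)).2 _ hd _
          (hR.degree r _ _ fun j => hu1 _)
      rw [h0, smul_zero, smul_zero]
  have h := weightPart_add_weightGeTwo
    (fun r => (actionFunctional ω Q r).compLinearMap fun _ => Φ)
  rwa [hzero, hone, zero_add] at h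

/-- The splitting intertwines the twisted vector field with `Q`. -/
theorem splitting_inducedTwistedVF [FiniteDimensional k V] (hQ : IsFormalModuliProblem 𝒯 Q)
    (hω : IsShiftedSymplectic n 𝒯 Q ω) (hR : IsGradedFormalMap 𝒱 𝒱 1 R)
    (hf : IsStrictMap 𝒱 R 𝒯 Q f) (hL : IsRegularEmbeddedLagrangian ω f)
    (hC : IsIsotropicComplement 𝒯 ω f C) (r : ℕ) (v : Fin r → V × Module.Dual k V) :
    splitting hω.nondegenerate hL hC.isCompl
        (inducedTwistedVF n 𝒱 R Q hω.nondegenerate hL hC.isCompl r v) =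
      Q r fun i => splitting hω.nondegenerate hL hC.isCompl (v i) := by
  -- Paired with Φ w, both sides give the value of S on Φ v₁, …, Φ v_r, Φ w.
  refine sub_eq_zero.1 (hω.nondegenerate.1 _ fun y => ?_)
  obtain ⟨w, rfl⟩ := splitting_surjective hω.nondegenerate hL hC.isCompl y
  rw [map_sub, LinearMap.sub_apply, apply_splitting_splitting hω hf.degree hL hC, inducedTwistedVF,
    twistedCotangentVF, cotangentVF, hamiltonianVF_add,
    linearHamiltonian_add_inducedPoisson hQ hω hR hf hL hC, apply_hamiltonianVF,
    MultilinearMap.compLinearMap_apply, actionFunctional_succ]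
  have hinit : Fin.init (α := fun _ => T) (fun i => splitting hω.nondegenerate hL hC.isCompl
      (Fin.snoc (α := fun _ => V × Module.Dual k V) v w i)) =
      fun i => splitting hω.nondegenerate hL hC.isCompl (v i) := by
    funext i
    simp [Fin.init]
  rw [hinit, Fin.snoc_last, sub_self]

end Splitting

end ShiftedPoisson

end

/-! ### Transport of all structures along the splitting -/

theorem mainTheorem6 {k : Type*} [Field k] [CharZero k] (n : ℤ)
    {T : Type*} [AddCommGroup T] [Module k T] [FiniteDimensional k T]
    (𝒯 : ℤ → Submodule k T) [DirectSum.Decomposition 𝒯]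
    (Q : FormalMap k T T) (hQ : IsFormalModuliProblem 𝒯 Q)
    (ω : LinearMap.BilinForm k T) (hω : IsShiftedSymplectic n 𝒯 Q ω)
    {V : Type*} [AddCommGroup V] [Module k V] [FiniteDimensional k V]
    (𝒱 : ℤ → Submodule k V) [DirectSum.Decomposition 𝒱]
    (R : FormalMap k V V) (hR : IsFormalModuliProblem 𝒱 R)
    (f : V →ₗ[k] T) (hf : IsStrictMap 𝒱 R 𝒯 Q f) (hL : IsRegularEmbeddedLagrangian ω f) :
    (∃ C : Submodule k T, IsIsotropicComplement 𝒯 ω f C) ∧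
    ∀ (C : Submodule k T) (hC : IsIsotropicComplement 𝒯 ω f C),
      IsHomotopyPoisson n 𝒱 R (inducedPoisson Q hω.nondegenerate hL hC.isCompl) ∧
      IsFormalModuliProblem (cotangentGrading n 𝒱)
        (inducedTwistedVF n 𝒱 R Q hω.nondegenerate hL hC.isCompl) ∧
      IsShiftedSymplectic n (cotangentGrading n 𝒱)
        (inducedTwistedVF n 𝒱 R Q hω.nondegenerate hL hC.isCompl)
        (cotangentForm n 𝒱) ∧
      IsStrictMap 𝒱 R (cotangentGrading n 𝒱)
        (inducedTwistedVF n 𝒱 R Q hω.nondegenerate hL hC.isCompl)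
        (zeroSection k V) ∧
      ∃ f' : V × Module.Dual k V →ₗ[k] T,
        IsStrictMap (cotangentGrading n 𝒱)
          (inducedTwistedVF n 𝒱 R Q hω.nondegenerate hL hC.isCompl) 𝒯 Q f' ∧
        (∀ x y, ω (f' x) (f' y) = cotangentForm n 𝒱 x y) ∧
        f' ∘ₗ zeroSection k V = f := by
  refine ⟨exists_isIsotropicComplement hω hf.degree hL, fun C hC => ?_⟩
  have hinj := splitting_injective hω hf.degree hL hC
  have hsurj := splitting_surjective hω.nondegenerate hL hC.isCompl
  have hgrad := mem_cotangentGrading_iff hω hf.degree hL hC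
  have hsymp := apply_splitting_splitting hω hf.degree hL hC
  have hVF := splitting_inducedTwistedVF hQ hω hR.graded hf hL hC
  have hS := linearHamiltonian_add_inducedPoisson hQ hω hR.graded hf hL hC
  let e : (V × Module.Dual k V) ≃ₗ[k] T :=
    LinearEquiv.ofBijective (splitting hω.nondegenerate hL hC.isCompl) ⟨hinj, hsurj⟩
  refine ⟨⟨?_, weightPart_weightGeTwo (by norm_num) _, weightPart_weightGeTwo (by norm_num) _, ?_⟩,
    hQ.of_linearEquiv e hgrad hVF,
    hω.of_linearEquiv e hgrad hVF hsymp (cotangentForm_nondegenerate n 𝒱), ⟨?_, ?_⟩,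
    splitting hω.nondegenerate hL hC.isCompl, ⟨fun i v hv => (hgrad i v).1 hv, hVF⟩, hsymp, ?_⟩
  · exact ((isGradedFormalMap_actionFunctional hQ.graded hω).compLinearMap
      fun i v hv => (hgrad i v).1 hv).weightGeTwo
  · intro r a u hu
    -- The field of the sum R + Π̄ is the twisted field, which is Φ-related to Q, so the bracket is
    -- the pullback of {S, S}.
    have hX : hamiltonianVF (cotangentForm n 𝒱) (cotangentForm_nondegenerate n 𝒱)
        (linearHamiltonian n 𝒱 R + inducedPoisson Q hω.nondegenerate hL hC.isCompl) =
        inducedTwistedVF n 𝒱 R Q hω.nondegenerate hL hC.isCompl := (hamiltonianVF_add _ _ _ _).symm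
    rw [poissonBracket, hX, hS]
    exact (map_derivAlong (F := fun r => (actionFunctional ω Q r).compLinearMap
      fun _ => splitting hω.nondegenerate hL hC.isCompl)
      (splitting hω.nondegenerate hL hC.isCompl) LinearMap.id hVF (fun _ _ => rfl) a u).trans
      (derivAlong_actionFunctional hQ hω a _ fun i => (hgrad _ _).1 (hu i))
  · intro i v hv
    exact Submodule.mem_prod.2 ⟨hv, Submodule.zero_mem _⟩
  · intro r v
    -- After applying Φ, strictness of the zero section becomes strictness of f.
    apply hinj
    rw [hVF, zeroSection]
    simp only [LinearMap.inl_apply, splitting_inl]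
    exact hf.comm r v
  · ext a
    simp [zeroSection, splitting_inl]
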